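/- Let $k$ be an algebraically closed field of odd characteristic $p$, let $n=p^st$ with $s\ge 0$ and $p\nmid t$, and let $\xi\in k$ be a primitive $t$-th root of unity. Let $D_n=\langle a,b\mid a^n=b^2=(ab)^2=1\rangle$ be the dihedral group of order $2n$. For $1\le r\le p^s$ and an integer $i\geq 0$, let $A_{r,i}\in M_r(k)$ be the upper triangular Jordan block with eigenvalue $\xi^i$ (ones on the superdiagonal). For $c\in\{1,-1\}$ let $T_r^{(c)}=(t_{jl})\in M_r(k)$ be the upper triangular matrix determined by $t_{rr}=1$, $t_{jj}=-t_{j+1,j+1}$ for $1\le j<r$, and $t_{jl}=-c\,t_{j+1,l}-t_{j+1,l+1}$ for $1\le j<l\le r$, where $t_{j+1,r+1}:=0$. Consider the following matrix representations of $D_n$ over $k$, for $1\le r\le p^s$: - $\Phi_{r,0}$: $a\mapsto A_{r,0}$, $b\mapsto T_r^{(1)}$; and $\Phi'_{r,0}$: $a\mapsto A_{r,0}$, $b\mapsto -T_r^{(1)}$; - if $n$ (equivalently $t$) is even, $\Phi_{r,t/2}$: $a\mapsto A_{r,t/2}$, $b\mapsto T_r^{(-1)}$; and $\Phi'_{r,t/2}$: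 $a\mapsto A_{r,t/2}$, $b\mapsto -T_r^{(-1)}$ (here $\xi^{t/2}=-1$); - $\Omega_{2r,i}$: $a\mapsto\begin{pmatrix}A_{r,i}&0\\0&A_{r,i}^{-1}\end{pmatrix}$, $b\mapsto\begin{pmatrix}0&I_r\\I_r&0\end{pmatrix}$, the representation induced from the representation $a\mapsto A_{r,i}$ of $\langle a\rangle$. Then: (1) If $n$ is odd, the representations $\Phi_{r,0}$, $\Phi'_{r,0}$, $\Omega_{2r,i}$ with $1\le r\le p^s$ and $1\le i\le\frac{t-1}{2}$ form a complete set of pairwise non-isomorphic finite-dimensional indecomposable representations of $kD_n$: each of them is indecomposable, no two of them (with different labels) are isomorphic, and every finite-dimensional indecomposable representation of $kD_n$ is isomorphic to one of them. (2) If $n$ is even, the same holds for the representations $\Phi_{r,0}$, $\Phi'_{r,0}$, $\Phi_{r,t/2}$, $\Phi'_{r,t/2}$, $\Omega_{2r,i}$ with $1\le r\le p^s$ and $1\le i\le\frac t2-1$. -/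

import Mathlib

open scoped Matrix

universe u v w

noncomputable section

namespace DihedralRep

section General

variable {k : Type u} [Field k] {G : Type v} [Group G]

/-- A representation is indecomposable if it is nonzero and is not the internal direct sum of two
nonzero subrepresentations. -/
def IsIndecomposable {V : Type w} [AddCommGroup V] [Module k V] (ρ : Representation k G V) :
    Prop :=
  Nontrivial V ∧ ∀ W₁ W₂ : Subrepresentation ρ, IsCompl W₁ W₂ → W₁ = ⊥ ∨ W₂ = ⊥

/-- The family `X` is a complete set of pairwise non-isomorphic finite-dimensional indecomposable
representations of `G` over `k`; completeness is tested on representations whose underlying space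
lies in an arbitrary universe `w`. -/
def IsCompleteIndecomposableFamily {ι : Type} (X : ι → Rep.{u} k G) : Prop :=
  (∀ x, Module.Finite k (X x).V ∧ IsIndecomposable (X x).ρ) ∧
  (∀ x y, Nonempty ((X x).ρ.Equiv (X y).ρ) → x = y) ∧
  (∀ (V : Type w) [AddCommGroup V] [Module k V] [Module.Finite k V]
    (ρ : Representation k G V), IsIndecomposable ρ → ∃ x, Nonempty (ρ.Equiv (X x).ρ))

/-- The representation on column vectors given by a matrix representation. -/
def ofMatrixHom {m : Type} [Fintype m] [DecidableEq m] (f : G →* Matrix m m k) :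
    Representation k G (m → k) :=
  ((Matrix.toLinAlgEquiv' : Matrix m m k ≃ₐ[k] ((m → k) →ₗ[k] (m → k))) :
    Matrix m m k →* ((m → k) →ₗ[k] (m → k))).comp f

end General

section Hom

variable {M : Type u} [Monoid M] {n : ℕ}

lemma pow_val_add {A : M} (hn : n ≠ 0) (hA : A ^ n = 1) (i j : ZMod n) :
    A ^ (i + j).val = A ^ i.val * A ^ j.val := by
  have : NeZero n := ⟨hn⟩
  rw [ZMod.val_add, ← pow_add]
  exact (pow_mod_natCard_aux hA _).symm
where
  pow_mod_natCard_aux {A : M} (hA : A ^ n = 1) (m : ℕ) : A ^ m = A ^ (m % n) := by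
    conv_lhs => rw [← Nat.mod_add_div m n, pow_add, pow_mul, hA, one_pow, mul_one]

lemma pow_mul_swap {A B : M} (hAB : A * B * A = B) (m : ℕ) : A ^ m * B * A ^ m = B := by
  induction m with
  | zero => simp
  | succ m ih =>
    calc A ^ (m + 1) * B * A ^ (m + 1) = A ^ m * (A * B * A) * A ^ m := by
          rw [pow_succ A m]
          nth_rewrite 2 [← pow_succ]
          rw [pow_succ']
          simp only [mul_assoc]
      _ = B := by rw [hAB, ih]

lemma pow_sub_mul {A B : M} (hn : n ≠ 0) (hA : A ^ n = 1) (hAB : A * B * A = B)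
    (i j : ZMod n) : B * A ^ (j - i).val = A ^ i.val * B * A ^ j.val := by
  conv_rhs => rw [← sub_add_cancel j i, add_comm, pow_val_add hn hA, ← mul_assoc,
    pow_mul_swap hAB]

/-- The homomorphism from the dihedral group `⟨a, b | a ^ n = b ^ 2 = (a * b) ^ 2 = 1⟩`, with
`a = r 1`, `b = sr 0`, sending `a` to `A` and `b` to `B`. -/
def homOfGens (A B : M) (hn : n ≠ 0) (hA : A ^ n = 1) (hB : B * B = 1) (hAB : A * B * A = B) :
    DihedralGroup n →* M where
  toFun
    | .r i => A ^ i.val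
    | .sr i => B * A ^ i.val
  map_one' := by
    have : NeZero n := ⟨hn⟩
    change A ^ (0 : ZMod n).val = 1
    simp
  map_mul' x y := by
    rcases x with i | i <;> rcases y with j | j
    · exact pow_val_add hn hA i j
    · change B * A ^ (j - i).val = A ^ i.val * (B * A ^ j.val)
      rw [pow_sub_mul hn hA hAB, mul_assoc]
    · change B * A ^ (i + j).val = B * A ^ i.val * A ^ j.val
      rw [pow_val_add hn hA, mul_assoc]
    · change A ^ (j - i).val = B * A ^ i.val * (B * A ^ j.val)
      have h := pow_sub_mul hn hA hAB i j
      calc A ^ (j - i).val = B * (B * A ^ (j - i).val) := by rw [← mul_assoc, hB, one_mul]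
        _ = _ := by rw [h]; simp only [mul_assoc]

lemma homOfGens_a (A B : M) (hn : n ≠ 0) (hA : A ^ n = 1) (hB : B * B = 1)
    (hAB : A * B * A = B) : homOfGens A B hn hA hB hAB (.r 1) = A := by
  change A ^ (1 : ZMod n).val = A
  rcases eq_or_ne n 1 with rfl | h1
  · rw [pow_one] at hA
    rw [hA, one_pow]
  · have : Fact (1 < n) := ⟨by omega⟩
    rw [ZMod.val_one, pow_one]

lemma homOfGens_b (A B : M) (hn : n ≠ 0) (hA : A ^ n = 1) (hB : B * B = 1)
    (hAB : A * B * A = B) : homOfGens A B hn hA hB hAB (.sr 0) = B := by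
  change B * A ^ (0 : ZMod n).val = B
  simp

end Hom

section Matrices

variable {k : Type u} [Field k]

/-- The `r × r` upper triangular Jordan block with eigenvalue `c`. -/
def jordan (r : ℕ) (c : k) : Matrix (Fin r) (Fin r) k :=
  Matrix.of fun i j => if i = j then c else if i.val + 1 = j.val then 1 else 0

/-- The entries of `invol`, with rows and columns counted from the last one (starting at `0`). -/
def involEntry (c : k) : ℕ → ℕ → k
  | 0, 0 => 1
  | 0, _ + 1 => 0
  | m + 1, 0 => -c * involEntry c m 0
  | m + 1, l + 1 => -c * involEntry c m (l + 1) - involEntry c m l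

/-- The upper triangular `r × r` matrix `(t i j)` with last diagonal entry `1`,
`t i i = -t (i+1) (i+1)` and `t i j = -c * t (i+1) j - t (i+1) (j+1)` for `i < j`
(where entries in column `r + 1` are read as `0`). -/
def invol (r : ℕ) (c : k) : Matrix (Fin r) (Fin r) k :=
  Matrix.of fun i j => involEntry c i.rev j.rev

lemma involEntry_eq_coeff (c : k) (m l : ℕ) :
    involEntry c m l = ((-(Polynomial.C c + Polynomial.X)) ^ m : Polynomial k).coeff l := by
  induction m generalizing l with
  | zero => cases l <;> simp [involEntry, Polynomial.coeff_one]
  | succ m ih =>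
    have : (-(Polynomial.C c + Polynomial.X)) ^ (m + 1) =
        -(Polynomial.C c * (-(Polynomial.C c + Polynomial.X)) ^ m) -
          Polynomial.X * (-(Polynomial.C c + Polynomial.X)) ^ m := by ring
    rw [this]
    cases l <;> simp [involEntry, ih]

lemma involEntry_eq_zero (c : k) {m l : ℕ} (h : m < l) : involEntry c m l = 0 := by
  rw [involEntry_eq_coeff]
  refine Polynomial.coeff_eq_zero_of_natDegree_lt (lt_of_le_of_lt ?_ h)
  compute_degree

lemma invol_apply_self_last (r : ℕ) (c : k) : invol (r + 1) c (Fin.last r) (Fin.last r) = 1 := by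
  simp [invol, involEntry]

lemma invol_apply_of_gt (r : ℕ) (c : k) {i j : Fin r} (h : j < i) : invol r c i j = 0 :=
  involEntry_eq_zero c (Fin.rev_lt_rev.mpr h)

lemma invol_apply_self {r : ℕ} (c : k) (i : Fin r) (hi : i.val + 1 < r) :
    invol r c i i = -invol r c ⟨i.val + 1, hi⟩ ⟨i.val + 1, hi⟩ := by
  have h : r - (i.val + 1) = (r - (i.val + 1 + 1)) + 1 := by omega
  simp only [invol, Matrix.of_apply, Fin.val_rev]
  rw [h, involEntry, involEntry_eq_zero c (Nat.lt_succ_self _)]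
  simp

lemma invol_apply_of_lt {r : ℕ} (c : k) {i j : Fin r} (h : i < j) :
    invol r c i j = -c * invol r c ⟨i.val + 1, by omega⟩ j -
      (if hj : j.val + 1 < r then invol r c ⟨i.val + 1, by omega⟩ ⟨j.val + 1, hj⟩ else 0) := by
  have hi : r - (i.val + 1) = (r - (i.val + 1 + 1)) + 1 := by omega
  simp only [invol, Matrix.of_apply, Fin.val_rev]
  split_ifs with hj
  · have hj' : r - (j.val + 1) = (r - (j.val + 1 + 1)) + 1 := by omega
    rw [hi, hj', involEntry]
  · have hj' : r - (j.val + 1) = 0 := by omega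
    rw [hi, hj', involEntry, sub_zero]

lemma invol_mul_self (r : ℕ) (c : k) : invol r c * invol r c = 1 := by
  ext i l
  rw [Matrix.mul_apply]
  simp only [invol, Matrix.of_apply]
  refine (Equiv.sum_comp Fin.revPerm
    (fun j : Fin r => involEntry c i.rev j * involEntry c j l.rev)).trans ?_
  have hP : (((-(Polynomial.C c + Polynomial.X)) ^ i.rev.val : Polynomial k).comp
      (-(Polynomial.C c + Polynomial.X))) = Polynomial.X ^ i.rev.val := by
    simp
  have hdeg : ((-(Polynomial.C c + Polynomial.X)) ^ i.rev.val : Polynomial k).natDegree < r := by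
    refine lt_of_le_of_lt (b := i.rev.val * 1) ?_ (by omega)
    exact Polynomial.natDegree_pow_le_of_le _ (by compute_degree)
  have h := congrArg (fun P : Polynomial k => P.coeff l.rev.val) hP
  rw [Polynomial.comp, Polynomial.eval₂_eq_sum_range' _ hdeg] at h
  simp only [Polynomial.finsetSum_coeff, Polynomial.coeff_C_mul, ← involEntry_eq_coeff,
    Polynomial.coeff_X_pow] at h
  rw [Fin.sum_univ_eq_sum_range (fun j => involEntry c i.rev j * involEntry c j l.rev) r, h,
    Matrix.one_apply]
  simp only [Fin.val_inj, Fin.rev_inj, eq_comm]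

lemma jordan_mul_apply {r : ℕ} (c : k) (M : Matrix (Fin r) (Fin r) k) (i j : Fin r) :
    (jordan r c * M) i j =
      c * M i j + if h : i.val + 1 < r then M ⟨i.val + 1, h⟩ j else 0 := by
  have hJ : ∀ x : Fin r, jordan r c i x * M x j =
      (if x = i then c * M i j else 0) + (if i.val + 1 = x.val then M x j else 0) := by
    intro x
    simp only [jordan, Matrix.of_apply]
    by_cases hx : i = x
    · subst hx; simp
    · simp [hx, Ne.symm hx]
  rw [Matrix.mul_apply, Finset.sum_congr rfl fun x _ => hJ x, Finset.sum_add_distrib]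
  congr 1
  · simp
  · split_ifs with h
    · rw [Finset.sum_eq_single ⟨i.val + 1, h⟩]
      · simp
      · intro x _ hx
        exact if_neg fun hc => hx (Fin.ext hc.symm)
      · simp
    · exact Finset.sum_eq_zero fun x _ => if_neg fun hc => h (by omega)

lemma mul_jordan_apply {r : ℕ} (c : k) (M : Matrix (Fin r) (Fin r) k) (i j : Fin r) :
    (M * jordan r c) i j =
      c * M i j + if h : 0 < j.val then M i ⟨j.val - 1, by omega⟩ else 0 := by
  have hJ : ∀ x : Fin r, M i x * jordan r c x j =
      (if x = j then c * M i j else 0) + (if x.val + 1 = j.val then M i x else 0) := by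
    intro x
    simp only [jordan, Matrix.of_apply]
    by_cases hx : x = j
    · subst hx; simp [mul_comm]
    · simp [hx]
  rw [Matrix.mul_apply, Finset.sum_congr rfl fun x _ => hJ x, Finset.sum_add_distrib]
  congr 1
  · simp
  · split_ifs with h
    · rw [Finset.sum_eq_single ⟨j.val - 1, by omega⟩]
      · exact if_pos (by simp only; omega)
      · intro x _ hx
        exact if_neg fun hc => hx (Fin.ext (by simp only; omega))
      · simp
    · exact Finset.sum_eq_zero fun x _ => if_neg fun hc => by omega

lemma jordan_mul_invol_mul_jordan (r : ℕ) {c : k} (hc : c ^ 2 = 1) :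
    jordan r c * invol r c * jordan r c = invol r c := by
  ext i j
  rw [mul_jordan_apply]
  simp only [jordan_mul_apply]
  obtain ⟨m, hm⟩ : ∃ m, m = r - (i.val + 1) := ⟨_, rfl⟩
  obtain ⟨l, hl⟩ : ∃ l, l = r - (j.val + 1) := ⟨_, rfl⟩
  have hi := i.isLt
  have hj := j.isLt
  simp only [invol, Matrix.of_apply, Fin.val_rev, ← hm, ← hl]
  have h0 : ∀ m < r, 0 = j.val → involEntry c m (l + 1) = 0 := fun m hm' hj' =>
    involEntry_eq_zero c (by omega)
  cases m with
  | zero =>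
    have h1 : ¬ i.val + 1 < r := by omega
    simp only [h1, dite_false, add_zero]
    split_ifs with h2
    · have h3 : r - (j.val - 1 + 1) = l + 1 := by omega
      rw [h3]
      simp only [involEntry]
      linear_combination involEntry c 0 l * hc
    · linear_combination involEntry c 0 l * hc
  | succ m =>
    have h1 : i.val + 1 < r := by omega
    have h4 : r - (i.val + 1 + 1) = m := by omega
    simp only [h1, dite_true, h4]
    have h5 : involEntry c (m + 1) (l + 1) = -c * involEntry c m (l + 1) - involEntry c m l := rfl
    split_ifs with h2
    · have h3 : r - (j.val - 1 + 1) = l + 1 := by omega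
      rw [h3, h5]
      linear_combination (involEntry c (m + 1) l - involEntry c m (l + 1)) * hc
    · rw [h0 (m + 1) (by omega) (by omega), h0 m (by omega) (by omega)] at h5
      linear_combination involEntry c (m + 1) l * hc + c * h5

lemma jordan_zero_pow_apply (r m : ℕ) (i j : Fin r) :
    ((jordan r (0 : k)) ^ m) i j = if i.val + m = j.val then 1 else 0 := by
  induction m generalizing j with
  | zero => simp [Matrix.one_apply, Fin.ext_iff]
  | succ m ih =>
    rw [pow_succ, mul_jordan_apply]
    split_ifs <;> simp_all <;> omega

lemma jordan_pow {p s t n r : ℕ} [Fact p.Prime] [CharP k p] (hn : n = p ^ s * t)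
    (hr : r ≤ p ^ s) {c : k} (hc : c ^ t = 1) : jordan r c ^ n = 1 := by
  rcases Nat.eq_zero_or_pos r with rfl | hr0
  · exact Subsingleton.elim _ _
  have : NeZero r := ⟨hr0.ne'⟩
  have hJ : jordan r c = algebraMap k _ c + jordan r 0 := by
    ext i j
    simp only [jordan, Matrix.of_apply, Matrix.add_apply, Matrix.algebraMap_matrix_apply]
    split_ifs <;> simp
  have hN : (jordan r (0 : k)) ^ p ^ s = 0 := by
    ext i j
    rw [jordan_zero_pow_apply, if_neg (by omega)]
    rfl
  rw [hn, pow_mul, hJ, add_pow_char_pow_of_commute p s (Algebra.commutes c _), hN,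
    add_zero, ← pow_mul, mul_comm, pow_mul, ← map_pow, hc, map_one, one_pow]

lemma pow_half_sq {p s t n : ℕ} [Fact p.Prime] (hn : n = p ^ s * t) (hp2 : p ≠ 2) (he : Even n) {ξ : k}
    (hξ : IsPrimitiveRoot ξ t) : (ξ ^ (t / 2)) ^ 2 = 1 := by
  have ht : Even t := by
    rw [hn, Nat.even_mul] at he
    refine he.resolve_left fun h => ?_
    exact Nat.not_even_iff_odd.mpr (((Fact.out : p.Prime).odd_of_ne_two hp2).pow) h
  rw [← pow_mul, Nat.div_mul_cancel ht.two_dvd, hξ.pow_eq_one]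

end Matrices

section Representations

variable {k : Type u} [Field k] {p s t n r : ℕ} [Fact p.Prime] [CharP k p]

lemma ne_zero_of_eq (hn : n = p ^ s * t) (hp : ¬ p ∣ t) : n ≠ 0 := by
  rw [hn]
  exact mul_ne_zero (pow_ne_zero _ (Fact.out : p.Prime).ne_zero) fun h => hp (h ▸ dvd_zero p)

/-- The matrix representation `a ↦ J`, `b ↦ T` of the dihedral group, where `J` is the Jordan block
of size `r` with eigenvalue `c` (`c = 1` or `c = -1`), and `T = invol r c`. -/
def phi (hn : n = p ^ s * t) (hp : ¬ p ∣ t) (hr : r ≤ p ^ s) (c : k) (hct : c ^ t = 1)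
    (hc : c ^ 2 = 1) : DihedralGroup n →* Matrix (Fin r) (Fin r) k :=
  homOfGens (jordan r c) (invol r c) (ne_zero_of_eq hn hp) (jordan_pow hn hr hct)
    (invol_mul_self r c) (jordan_mul_invol_mul_jordan r hc)

/-- The matrix representation `a ↦ J`, `b ↦ -T` of the dihedral group, with `J`, `T` as in `phi`. -/
def phi' (hn : n = p ^ s * t) (hp : ¬ p ∣ t) (hr : r ≤ p ^ s) (c : k) (hct : c ^ t = 1)
    (hc : c ^ 2 = 1) : DihedralGroup n →* Matrix (Fin r) (Fin r) k :=
  homOfGens (jordan r c) (-invol r c) (ne_zero_of_eq hn hp) (jordan_pow hn hr hct)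
    (by rw [neg_mul_neg, invol_mul_self])
    (by rw [mul_neg, neg_mul, jordan_mul_invol_mul_jordan r hc])

lemma isUnit_det_jordan (hn : n = p ^ s * t) (hp : ¬ p ∣ t) (hr : r ≤ p ^ s) (c : k)
    (hct : c ^ t = 1) : IsUnit (jordan r c).det :=
  (Matrix.isUnit_iff_isUnit_det _).mp
    (IsUnit.of_pow_eq_one (jordan_pow hn hr hct) (ne_zero_of_eq hn hp))

/-- The matrix representation `a ↦ diag(J, J⁻¹)`, `b ↦ (0, 1; 1, 0)` of the dihedral group, where
`J` is the Jordan block of size `r` with eigenvalue `c`. -/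
def omega (hn : n = p ^ s * t) (hp : ¬ p ∣ t) (hr : r ≤ p ^ s) (c : k) (hct : c ^ t = 1) :
    DihedralGroup n →* Matrix (Fin r ⊕ Fin r) (Fin r ⊕ Fin r) k :=
  homOfGens (Matrix.fromBlocks (jordan r c) 0 0 (jordan r c)⁻¹) (Matrix.fromBlocks 0 1 1 0)
    (ne_zero_of_eq hn hp)
    (by rw [Matrix.fromBlocks_diagonal_pow, Matrix.inv_pow', jordan_pow hn hr hct, inv_one,
      Matrix.fromBlocks_one])
    (by simp [Matrix.fromBlocks_multiply])
    (by
      have h := isUnit_det_jordan hn hp hr c hct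
      simp [Matrix.fromBlocks_multiply, Matrix.mul_nonsing_inv _ h, Matrix.nonsing_inv_mul _ h])

/-- The representation `a ^ j ↦ J ^ j` of the rotation subgroup (with `J` the Jordan block of size
`r` and eigenvalue `c`), extended by zero to the whole dihedral group. -/
def rotationExt (n r : ℕ) (c : k) : DihedralGroup n → Matrix (Fin r) (Fin r) k
  | .r i => jordan r c ^ i.val
  | .sr _ => 0

/-- `omega` is the matrix representation induced from the rotation subgroup, with respect to the
left coset representatives `1`, `b`. -/
lemma omega_eq_induced (hn : n = p ^ s * t) (hp : ¬ p ∣ t) (hr : r ≤ p ^ s) (c : k)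
    (hct : c ^ t = 1) (g : DihedralGroup n) :
    omega hn hp hr c hct g =
      Matrix.fromBlocks (rotationExt n r c g) (rotationExt n r c (g * .sr 0))
        (rotationExt n r c ((.sr 0)⁻¹ * g)) (rotationExt n r c ((.sr 0)⁻¹ * g * .sr 0)) := by
  have h1 := jordan_pow hn hr hct
  have hinv : ∀ i : ZMod n, (jordan r c)⁻¹ ^ i.val = jordan r c ^ (-i).val := by
    intro i
    rw [Matrix.inv_pow']
    refine Matrix.inv_eq_right_inv ?_
    rw [← pow_val_add (ne_zero_of_eq hn hp) h1, add_neg_cancel, ZMod.val_zero, pow_zero]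
  rcases g with i | i
  · change (Matrix.fromBlocks (jordan r c) 0 0 (jordan r c)⁻¹) ^ i.val = _
    simp [Matrix.fromBlocks_diagonal_pow, rotationExt, hinv]
  · change Matrix.fromBlocks 0 1 1 0 * (Matrix.fromBlocks (jordan r c) 0 0 (jordan r c)⁻¹) ^ i.val = _
    simp [Matrix.fromBlocks_diagonal_pow, Matrix.fromBlocks_multiply, rotationExt, hinv]

/-- The labels `(r, 0)`, `(r, 0)'` and `(2r, i)` with `1 ≤ r ≤ q` and `1 ≤ i ≤ (t - 1) / 2`. -/
inductive OddLabel (q t : ℕ) : Type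
  | phi (r : ℕ) (hr : 1 ≤ r ∧ r ≤ q)
  | phi' (r : ℕ) (hr : 1 ≤ r ∧ r ≤ q)
  | omega (r i : ℕ) (hr : 1 ≤ r ∧ r ≤ q) (hi : 1 ≤ i ∧ i ≤ (t - 1) / 2)

/-- The labels `(r, 0)`, `(r, 0)'`, `(r, t / 2)`, `(r, t / 2)'` and `(2r, i)` with `1 ≤ r ≤ q` and
`1 ≤ i ≤ t / 2 - 1`. -/
inductive EvenLabel (q t : ℕ) : Type
  | phi (r : ℕ) (hr : 1 ≤ r ∧ r ≤ q)
  | phi' (r : ℕ) (hr : 1 ≤ r ∧ r ≤ q)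
  | phiHalf (r : ℕ) (hr : 1 ≤ r ∧ r ≤ q)
  | phiHalf' (r : ℕ) (hr : 1 ≤ r ∧ r ≤ q)
  | omega (r i : ℕ) (hr : 1 ≤ r ∧ r ≤ q) (hi : 1 ≤ i ∧ i ≤ t / 2 - 1)

lemma pow_pow_eq_one {ξ : k} (hξ : IsPrimitiveRoot ξ t) (i : ℕ) : (ξ ^ i) ^ t = 1 := by
  rw [← pow_mul, mul_comm, pow_mul, hξ.pow_eq_one, one_pow]

lemma pow_zero_sq (ξ : k) : (ξ ^ 0) ^ 2 = 1 := by simp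

/-- The family `Φ_{r,0}`, `Φ'_{r,0}`, `Ω_{2r,i}`. -/
def oddFamily (hn : n = p ^ s * t) (hp : ¬ p ∣ t) {ξ : k} (hξ : IsPrimitiveRoot ξ t) :
    OddLabel (p ^ s) t → Rep.{u} k (DihedralGroup n)
  | .phi _ hr => .of (ofMatrixHom (phi hn hp hr.2 (ξ ^ 0) (pow_pow_eq_one hξ 0) (pow_zero_sq ξ)))
  | .phi' _ hr => .of (ofMatrixHom (phi' hn hp hr.2 (ξ ^ 0) (pow_pow_eq_one hξ 0) (pow_zero_sq ξ)))
  | .omega _ i hr _ => .of (ofMatrixHom (omega hn hp hr.2 (ξ ^ i) (pow_pow_eq_one hξ i)))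

/-- The family `Φ_{r,0}`, `Φ'_{r,0}`, `Φ_{r,t/2}`, `Φ'_{r,t/2}`, `Ω_{2r,i}`. -/
def evenFamily (hn : n = p ^ s * t) (hp : ¬ p ∣ t) (hp2 : p ≠ 2) (he : Even n) {ξ : k}
    (hξ : IsPrimitiveRoot ξ t) : EvenLabel (p ^ s) t → Rep.{u} k (DihedralGroup n)
  | .phi _ hr => .of (ofMatrixHom (phi hn hp hr.2 (ξ ^ 0) (pow_pow_eq_one hξ 0) (pow_zero_sq ξ)))
  | .phi' _ hr => .of (ofMatrixHom (phi' hn hp hr.2 (ξ ^ 0) (pow_pow_eq_one hξ 0) (pow_zero_sq ξ)))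
  | .phiHalf _ hr => .of (ofMatrixHom
      (phi hn hp hr.2 (ξ ^ (t / 2)) (pow_pow_eq_one hξ _) (pow_half_sq hn hp2 he hξ)))
  | .phiHalf' _ hr => .of (ofMatrixHom
      (phi' hn hp hr.2 (ξ ^ (t / 2)) (pow_pow_eq_one hξ _) (pow_half_sq hn hp2 he hξ)))
  | .omega _ i hr _ => .of (ofMatrixHom (omega hn hp hr.2 (ξ ^ i) (pow_pow_eq_one hξ i)))

end Representations

end DihedralRep

end

/-! Write `a` for the rotation `r 1` and `b` for the reflection `sr 0`. Each model `M` in the lists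
has a nonzero vector `e` lying in every nonzero subrepresentation, which forces indecomposability.
If `a` acts by one Jordan block, `e` spans its only eigenline. In an `Ω` with `c ≠ c⁻¹`, the two
eigenlines of `a` are exchanged by `b`.

For completeness, let `V` be indecomposable, `c` an eigenvalue of `a` on `V`, and `y = a - c`. Let
`r` be the multiplicity of `c` in the minimal polynomial of `a`. `exists_jordan_chain` gives a
vector `v` with `y ^ r v = 0` and a functional `f` vanishing on the image of `y ^ r`, with `f (y ^
(r - 1) v) ≠ 0`. They define maps `M → V` and `V → M` commuting with `a`; averaging over `1, b`,
possible since `2` is invertible, gives intertwining maps `j` and `π`. If `π (j e) ≠ 0`, the kernel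
of `π ∘ j` misses `e`, so `π ∘ j` is an automorphism of `M`, `V = im j ⊕ ker π`, and `V ≅ M`
(`nonempty_equiv_of_apply_ne_zero`).

For `c ≠ c⁻¹` the averages cannot cancel, because `b` exchanges the two blocks of `M`. For `c = ±1`
they could, so `v` is first changed until `y ^ (r - 1) v` is an eigenvector of `b`
(`exists_refl_eigen_chain`); its sign selects `Φ` or `Φ'`. The bound `r ≤ p ^ s` comes from `a ^ n =
1` and `p ∤ t`.

Isomorphism classes are told apart by dimension, by the eigenvalues of `a`, and by the eigenvalue
pairs on common eigenvectors of `a` and `b`. -/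

noncomputable section

namespace DihedralRep

/-! ### Socle vectors, indecomposability and the splitting criterion -/

section Socle

variable {k : Type u} [Field k] {G : Type v} [Group G]

/-- A nonzero vector contained in every nonzero subrepresentation. -/
def IsSocleVector {V : Type w} [AddCommGroup V] [Module k V] (ρ : Representation k G V) (e : V) :
    Prop :=
  e ≠ 0 ∧ ∀ W : Subrepresentation ρ, W ≠ ⊥ → e ∈ W

/-- Two nonzero complements would both contain `e`. -/
lemma IsSocleVector.isIndecomposable {V : Type w} [AddCommGroup V] [Module k V]
    {ρ : Representation k G V} {e : V} (he : IsSocleVector ρ e) : IsIndecomposable ρ := by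
  refine ⟨⟨e, 0, he.1⟩, fun W₁ W₂ h => ?_⟩
  by_contra! hW
  have hmem : e ∈ W₁ ⊓ W₂ := ⟨he.2 W₁ hW.1, he.2 W₂ hW.2⟩
  rw [h.inf_eq_bot] at hmem
  exact he.1 ((Submodule.mem_bot k).mp hmem)

lemma exists_eigenvector_mem [IsAlgClosed k] {V : Type w} [AddCommGroup V] [Module k V]
    [Module.Finite k V] {ρ : Representation k G V} (W : Subrepresentation ρ) (hW : W ≠ ⊥) (g : G) :
    ∃ μ : k, ∃ z ∈ W, z ≠ 0 ∧ ρ g z = μ • z := by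
  have hne : W.toSubmodule ≠ ⊥ := fun h => hW (Subrepresentation.toSubmodule_injective h)
  have : Nontrivial W.toSubmodule := Submodule.nontrivial_iff_ne_bot.mpr hne
  obtain ⟨μ, hμ⟩ := Module.End.exists_eigenvalue (W.toRepresentation g)
  obtain ⟨z, hz⟩ := hμ.exists_hasEigenvector
  refine ⟨μ, z, z.2, fun h => hz.2 (Subtype.ext h), ?_⟩
  exact congrArg Subtype.val hz.apply_eq_smul

/-- A nonzero kernel of `π ∘ j` would contain `e`; so `π ∘ j` is bijective on the finite-dimensional
`M`, and the image of `j` is a direct summand with complement `ker π`. Indecomposability kills the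
complement. -/
lemma nonempty_equiv_of_apply_ne_zero {V : Type w} {M : Type u} [AddCommGroup V] [Module k V]
    [AddCommGroup M] [Module k M] [Module.Finite k M] {ρ : Representation k G V}
    {σ : Representation k G M} (hρ : IsIndecomposable ρ) {e : M} (he : IsSocleVector σ e)
    (j : σ.IntertwiningMap ρ) (π : ρ.IntertwiningMap σ) (h : π (j e) ≠ 0) :
    Nonempty (ρ.Equiv σ) := by
  have hinj : Function.Injective (π.toLinearMap ∘ₗ j.toLinearMap) := by
    rw [← LinearMap.ker_eq_bot]
    by_contra hk
    exact h (he.2 (π.comp j).ker fun hb => hk (congrArg Subrepresentation.toSubmodule hb))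
  have hsurj := LinearMap.injective_iff_surjective.mp hinj
  have hcompl : IsCompl j.toLinearMap.range π.toLinearMap.ker := by
    refine ⟨Submodule.disjoint_def.mpr ?_, codisjoint_iff.mpr (eq_top_iff.mpr fun x _ => ?_)⟩
    · rintro _ ⟨m, rfl⟩ hm
      rw [hinj (hm.trans (map_zero (π.toLinearMap ∘ₗ j.toLinearMap)).symm), map_zero]
    · obtain ⟨m, hm⟩ := hsurj (π.toLinearMap x)
      refine Submodule.mem_sup.mpr ⟨j.toLinearMap m, ⟨m, rfl⟩, x - j.toLinearMap m, ?_, by abel⟩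
      rw [LinearMap.mem_ker, map_sub, ← hm, LinearMap.comp_apply, sub_self]
  have hcompl' : IsCompl j.range π.ker := by
    refine ⟨?_, ?_⟩
    · rw [disjoint_iff]
      exact Subrepresentation.toSubmodule_injective hcompl.inf_eq_bot
    · rw [codisjoint_iff]
      exact Subrepresentation.toSubmodule_injective hcompl.sup_eq_top
  have hker : π.ker = ⊥ := by
    refine (hρ.2 _ _ hcompl').resolve_left fun hb => h ?_
    have hmem : j e ∈ j.range := ⟨e, rfl⟩
    rw [hb] at hmem
    rw [(Submodule.mem_bot k).mp hmem, map_zero]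
  have hbij : Function.Bijective π.toLinearMap :=
    ⟨LinearMap.ker_eq_bot.mp (congrArg Subrepresentation.toSubmodule hker),
      fun x => (hsurj x).imp' j.toLinearMap fun _ hm => hm⟩
  exact ⟨.mk (LinearEquiv.ofBijective π.toLinearMap hbij) π.isIntertwining'⟩

end Socle

/-! ### Intertwining maps from generators, and averaging over the reflection -/

section Generators

variable {k : Type u} [Field k] {n : ℕ}

lemma r_eq_r_one_pow (hn : n ≠ 0) (i : ZMod n) : DihedralGroup.r i = .r 1 ^ i.val := by
  have : NeZero n := ⟨hn⟩
  rw [DihedralGroup.r_one_pow, ZMod.natCast_zmod_val]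

lemma sr_eq_sr_zero_mul (hn : n ≠ 0) (i : ZMod n) :
    DihedralGroup.sr i = .sr 0 * .r 1 ^ i.val := by
  rw [← r_eq_r_one_pow hn, DihedralGroup.sr_mul_r, zero_add]

variable {V : Type v} {M : Type w} [AddCommGroup V] [Module k V] [AddCommGroup M] [Module k M]

lemma r_one_mul_sr_zero_mul_r_one (n : ℕ) :
    (.r 1 * .sr 0 * .r 1 : DihedralGroup n) = .sr 0 := by
  simp

lemma rep_aba (ρ : Representation k (DihedralGroup n) V) (x : V) :
    ρ (.r 1) (ρ (.sr 0) (ρ (.r 1) x)) = ρ (.sr 0) x := by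
  rw [← Module.End.mul_apply, ← Module.End.mul_apply, ← map_mul, ← map_mul,
    r_one_mul_sr_zero_mul_r_one]

lemma rep_bb (ρ : Representation k (DihedralGroup n) V) (x : V) :
    ρ (.sr 0) (ρ (.sr 0) x) = x := by
  rw [← Module.End.mul_apply, ← map_mul, DihedralGroup.sr_mul_self, map_one, Module.End.one_apply]

/-- A linear map commuting with both generators of the dihedral group is an intertwining map. -/
def intertwiningMapOfGens (hn : n ≠ 0) {ρ : Representation k (DihedralGroup n) V}
    {σ : Representation k (DihedralGroup n) M} (φ : M →ₗ[k] V)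
    (ha : ∀ x, φ (σ (.r 1) x) = ρ (.r 1) (φ x)) (hb : ∀ x, φ (σ (.sr 0) x) = ρ (.sr 0) (φ x)) :
    σ.IntertwiningMap ρ :=
  have hpow : ∀ (m : ℕ) (x : M), φ (σ (.r 1 ^ m) x) = ρ (.r 1 ^ m) (φ x) := fun m x => by
    induction m generalizing x with
    | zero => simp
    | succ m ih =>
      rw [pow_succ, map_mul, map_mul, Module.End.mul_apply, Module.End.mul_apply, ih, ha]
  φ.intertwiningMap_of_isIntertwiningMap σ ρ fun g x => by
    rcases g with i | i
    · rw [r_eq_r_one_pow hn, hpow]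
    · rw [sr_eq_sr_zero_mul hn, map_mul, map_mul, Module.End.mul_apply, Module.End.mul_apply, hb,
        hpow]

/-- The average `(φ + b φ b) / 2` of a linear map `φ` commuting with the rotations. -/
def average (hn : n ≠ 0) (ρ : Representation k (DihedralGroup n) V)
    (σ : Representation k (DihedralGroup n) M) (φ : M →ₗ[k] V)
    (ha : ∀ x, φ (σ (.r 1) x) = ρ (.r 1) (φ x)) : σ.IntertwiningMap ρ :=
  intertwiningMapOfGens hn ((2 : k)⁻¹ • (φ + ρ (.sr 0) ∘ₗ φ ∘ₗ σ (.sr 0)))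
    (fun x => by
      simp only [LinearMap.smul_apply, LinearMap.add_apply, LinearMap.comp_apply, map_smul,
        map_add, ha]
      -- In `a b φ (b x)`, expand `b x` as `a b a x`; then `φ` lets the outer `a` through, and `a b
      -- a = b` on the target absorbs it.
      rw [← rep_aba σ x, ha, rep_aba])
    (fun x => by
      simp only [LinearMap.smul_apply, LinearMap.add_apply, LinearMap.comp_apply, map_smul,
        map_add, rep_bb]
      rw [add_comm])

lemma average_apply (hn : n ≠ 0) (ρ : Representation k (DihedralGroup n) V)
    (σ : Representation k (DihedralGroup n) M) (φ : M →ₗ[k] V)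
    (ha : ∀ x, φ (σ (.r 1) x) = ρ (.r 1) (φ x)) (x : M) :
    average hn ρ σ φ ha x = (2 : k)⁻¹ • (φ x + ρ (.sr 0) (φ (σ (.sr 0) x))) := rfl

end Generators

/-! ### Jordan blocks: eigenvectors, and maps into and out of them -/

section Jordan

variable {k : Type u} [Field k] {r : ℕ}

lemma jordan_mulVec_apply (c : k) (x : Fin r → k) (i : Fin r) :
    (jordan r c *ᵥ x) i = c * x i + if h : i.val + 1 < r then x ⟨i.val + 1, h⟩ else 0 :=
  jordan_mul_apply c (Matrix.of fun i _ => x i) i i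

lemma jordan_mulVec_single (c : k) (i : Fin r) :
    jordan r c *ᵥ Pi.single i 1 = c • Pi.single i 1 +
      if h : 0 < i.val then Pi.single ⟨i.val - 1, by omega⟩ 1 else 0 := by
  ext l
  rw [jordan_mulVec_apply]
  simp only [Pi.add_apply, Pi.smul_apply, smul_eq_mul]
  congr 1
  split_ifs with h1 h2 h2
  · simp only [Pi.single_apply, Fin.ext_iff]
    congr 1
    simp only [eq_iff_iff]
    omega
  · simp only [Pi.single_apply, Fin.ext_iff, Pi.zero_apply]
    exact if_neg (by omega)
  · simp only [Pi.single_apply, Fin.ext_iff]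
    exact (if_neg (by omega)).symm
  · rfl

/-- Coordinatewise the eigenvector equation reads `x (i + 1) = (μ - c) * x i`, with `0` past the
end. If `μ ≠ c`, zeros propagate upwards from the last coordinate; if `μ = c`, every coordinate but
the first vanishes. -/
lemma jordan_eigenvector {c μ : k} (hr : 0 < r) {x : Fin r → k} (hx : x ≠ 0)
    (h : jordan r c *ᵥ x = μ • x) : μ = c ∧ x = x ⟨0, hr⟩ • Pi.single ⟨0, hr⟩ 1 := by
  have hi : ∀ i : Fin r,
      (if h : i.val + 1 < r then x ⟨i.val + 1, h⟩ else 0) = (μ - c) * x i := by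
    intro i
    have := congrFun h i
    rw [jordan_mulVec_apply, Pi.smul_apply, smul_eq_mul] at this
    linear_combination this
  have hμ : μ = c := by
    by_contra hne
    have hne : μ - c ≠ 0 := sub_ne_zero.mpr hne
    -- Here `d` is the distance of `i` from the last index.
    have hz : ∀ d, ∀ i : Fin r, i.val + d + 1 = r → x i = 0 := by
      intro d
      induction d with
      | zero =>
        intro i hd
        have := hi i
        rw [dif_neg (by omega)] at this
        exact (mul_eq_zero.mp this.symm).resolve_left hne
      | succ d ih =>
        intro i hd
        have := hi i
        rw [dif_pos (by omega), ih _ (by simp only; omega)] at this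
        exact (mul_eq_zero.mp this.symm).resolve_left hne
    exact hx (funext fun i => hz (r - (i.val + 1)) i (by omega))
  refine ⟨hμ, funext fun i => ?_⟩
  by_cases h0 : i = ⟨0, hr⟩
  · simp [h0]
  · have h0' : i.val ≠ 0 := fun h => h0 (Fin.ext h)
    have := hi ⟨i.val - 1, by omega⟩
    rw [hμ, sub_self, zero_mul, dif_pos (by simp only; omega)] at this
    simp only [Pi.smul_apply, Pi.single_eq_of_ne h0, smul_zero]
    rw [← this]
    congr 1
    exact Fin.ext (by simp only; omega)

variable {V : Type w} [AddCommGroup V] [Module k V]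

/-- The linear map sending the `i`-th standard basis vector to `(A - c) ^ (r - 1 - i) v`. -/
def jordanLift (A : Module.End k V) (c : k) (r : ℕ) (v : V) : (Fin r → k) →ₗ[k] V :=
  Fintype.linearCombination k fun i : Fin r => ((A - algebraMap k _ c) ^ (i.rev : ℕ)) v

/-- The linear map with coordinates `f ∘ (A - c) ^ i`. -/
def jordanColift (A : Module.End k V) (c : k) (r : ℕ) (f : V →ₗ[k] k) : V →ₗ[k] (Fin r → k) :=
  LinearMap.pi fun i => f ∘ₗ (A - algebraMap k _ c) ^ (i : ℕ)

lemma jordanLift_single (A : Module.End k V) (c : k) (v : V) (i : Fin r) :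
    jordanLift A c r v (Pi.single i 1) = ((A - algebraMap k _ c) ^ (i.rev : ℕ)) v := by
  rw [jordanLift, Fintype.linearCombination_apply_single, one_smul]

/-- The block minus `c` lowers the index by one, which matches one more factor `A - c` on the chain.
Only the basis vector of index `0` needs the hypothesis on `v`. -/
lemma jordanLift_jordan_mulVec {A : Module.End k V} {c : k} {v : V}
    (hv : ((A - algebraMap k _ c) ^ r) v = 0) (x : Fin r → k) :
    jordanLift A c r v (jordan r c *ᵥ x) = A (jordanLift A c r v x) := by
  have hA : ∀ z, A z = c • z + (A - algebraMap k _ c) z := fun z => by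
    simp [Module.algebraMap_end_apply]
  suffices h : jordanLift A c r v ∘ₗ (jordan r c).mulVecLin = A ∘ₗ jordanLift A c r v from
    LinearMap.congr_fun h x
  refine (Pi.basisFun k (Fin r)).ext fun i => ?_
  simp only [Pi.basisFun_apply, LinearMap.comp_apply, Matrix.mulVecLin_apply]
  rw [jordan_mulVec_single, map_add, map_smul, jordanLift_single, hA, ← Module.End.mul_apply,
    ← pow_succ']
  congr 1
  split_ifs with h
  · rw [jordanLift_single]
    congr 2
    simp only [Fin.val_rev]
    omega
  · have : (i.rev : ℕ) + 1 = r := by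
      simp only [Fin.val_rev]
      omega
    rw [this, hv, map_zero]

/-- Dual to the lift: the block shifts coordinates, and only the last coordinate needs `f` to vanish
on the image of `(A - c) ^ r`. -/
lemma jordan_mulVec_jordanColift {A : Module.End k V} {c : k} {f : V →ₗ[k] k}
    (hf : ∀ z, f (((A - algebraMap k _ c) ^ r) z) = 0) (z : V) :
    jordanColift A c r f (A z) = jordan r c *ᵥ jordanColift A c r f z := by
  have hA : A z = c • z + (A - algebraMap k _ c) z := by
    simp [Module.algebraMap_end_apply]
  ext i
  rw [jordan_mulVec_apply]
  simp only [jordanColift, LinearMap.pi_apply, LinearMap.comp_apply]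
  conv_lhs => rw [hA]
  rw [map_add, map_add, map_smul, map_smul, smul_eq_mul, ← Module.End.mul_apply, ← pow_succ]
  congr 1
  split_ifs with h
  · rfl
  · have : (i : ℕ) + 1 = r := by omega
    rw [this, hf]

lemma jordanColift_of_eigenvector {A : Module.End k V} {c : k} (f : V →ₗ[k] k) (hr : 0 < r) {z : V}
    (hz : (A - algebraMap k _ c) z = 0) :
    jordanColift A c r f z = f z • Pi.single ⟨0, hr⟩ 1 := by
  ext i
  simp only [jordanColift, LinearMap.pi_apply, LinearMap.comp_apply, Pi.smul_apply, smul_eq_mul]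
  by_cases h0 : i = ⟨0, hr⟩
  · simp [h0]
  · have h0' : i.val ≠ 0 := fun h => h0 (Fin.ext h)
    obtain ⟨m, hm⟩ := Nat.exists_eq_succ_of_ne_zero h0'
    rw [hm, Nat.succ_eq_add_one, pow_succ, Module.End.mul_apply, hz, map_zero, map_zero,
      Pi.single_eq_of_ne h0, mul_zero]

end Jordan

/-! ### Socle vectors of the model representations -/

section Models

lemma ne_zero_of_pow_eq_one {k : Type u} [Field k] {p t : ℕ} (hp : ¬ p ∣ t) {c : k}
    (hct : c ^ t = 1) : c ≠ 0 := by
  rintro rfl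
  rw [zero_pow fun h : t = 0 => hp (h ▸ dvd_zero p)] at hct
  exact zero_ne_one hct

variable {k : Type u} [Field k] {p s t n r : ℕ} [Fact p.Prime] [CharP k p]

lemma ofMatrixHom_apply {G : Type v} [Group G] {m : Type} [Fintype m] [DecidableEq m]
    (f : G →* Matrix m m k) (g : G) (x : m → k) : ofMatrixHom f g x = f g *ᵥ x := rfl

lemma involEntry_self (c : k) (m : ℕ) : involEntry c m m = (-1) ^ m := by
  induction m with
  | zero => simp [involEntry]
  | succ m ih =>
    rw [involEntry, involEntry_eq_zero c (Nat.lt_succ_self m), ih, pow_succ]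
    ring

/-- The matrix is triangular, so only its top diagonal entry matters; the signs alternate upwards
from `1` in the last row. -/
lemma invol_mulVec_single_zero (c : k) (hr : 0 < r) :
    invol r c *ᵥ Pi.single ⟨0, hr⟩ 1 = (-1 : k) ^ (r - 1) • Pi.single ⟨0, hr⟩ 1 := by
  ext i
  rw [Matrix.mulVec_single_one, Matrix.col_apply, Pi.smul_apply, smul_eq_mul]
  by_cases h0 : i = ⟨0, hr⟩
  · subst h0
    rw [Pi.single_eq_same, mul_one, invol, Matrix.of_apply, involEntry_self, Fin.val_rev]
  · rw [Pi.single_eq_of_ne h0, mul_zero]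
    exact invol_apply_of_gt r c (Fin.lt_def.mpr (Nat.pos_of_ne_zero fun h => h0 (Fin.ext h)))

lemma phi_rot (hn : n = p ^ s * t) (hp : ¬ p ∣ t) (hr : r ≤ p ^ s) (c : k) (hct : c ^ t = 1)
    (hc : c ^ 2 = 1) (x : Fin r → k) :
    ofMatrixHom (phi hn hp hr c hct hc) (.r 1) x = jordan r c *ᵥ x := by
  rw [ofMatrixHom_apply, phi, homOfGens_a]

lemma phi'_rot (hn : n = p ^ s * t) (hp : ¬ p ∣ t) (hr : r ≤ p ^ s) (c : k) (hct : c ^ t = 1)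
    (hc : c ^ 2 = 1) (x : Fin r → k) :
    ofMatrixHom (phi' hn hp hr c hct hc) (.r 1) x = jordan r c *ᵥ x := by
  rw [ofMatrixHom_apply, phi', homOfGens_a]

lemma phi_refl_single (hn : n = p ^ s * t) (hp : ¬ p ∣ t) (hr : r ≤ p ^ s) (c : k)
    (hct : c ^ t = 1) (hc : c ^ 2 = 1) (h0 : 0 < r) :
    ofMatrixHom (phi hn hp hr c hct hc) (.sr 0) (Pi.single ⟨0, h0⟩ 1) =
      (-1 : k) ^ (r - 1) • Pi.single ⟨0, h0⟩ 1 := by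
  rw [ofMatrixHom_apply, phi, homOfGens_b, invol_mulVec_single_zero]

lemma phi'_refl_single (hn : n = p ^ s * t) (hp : ¬ p ∣ t) (hr : r ≤ p ^ s) (c : k)
    (hct : c ^ t = 1) (hc : c ^ 2 = 1) (h0 : 0 < r) :
    ofMatrixHom (phi' hn hp hr c hct hc) (.sr 0) (Pi.single ⟨0, h0⟩ 1) =
      (-(-1) ^ (r - 1) : k) • Pi.single ⟨0, h0⟩ 1 := by
  rw [ofMatrixHom_apply, phi', homOfGens_b, Matrix.neg_mulVec, invol_mulVec_single_zero, neg_smul]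

lemma omega_rot_inl (hn : n = p ^ s * t) (hp : ¬ p ∣ t) (hr : r ≤ p ^ s) (c : k)
    (hct : c ^ t = 1) (x : Fin r ⊕ Fin r → k) :
    (ofMatrixHom (omega hn hp hr c hct) (.r 1) x) ∘ Sum.inl = jordan r c *ᵥ (x ∘ Sum.inl) := by
  rw [ofMatrixHom_apply, omega, homOfGens_a, Matrix.fromBlocks_mulVec]
  simp

lemma omega_rot_inr (hn : n = p ^ s * t) (hp : ¬ p ∣ t) (hr : r ≤ p ^ s) (c : k)
    (hct : c ^ t = 1) (x : Fin r ⊕ Fin r → k) :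
    (ofMatrixHom (omega hn hp hr c hct) (.r 1) x) ∘ Sum.inr = (jordan r c)⁻¹ *ᵥ (x ∘ Sum.inr) := by
  rw [ofMatrixHom_apply, omega, homOfGens_a, Matrix.fromBlocks_mulVec]
  simp

lemma omega_refl (hn : n = p ^ s * t) (hp : ¬ p ∣ t) (hr : r ≤ p ^ s) (c : k)
    (hct : c ^ t = 1) (x : Fin r ⊕ Fin r → k) :
    ofMatrixHom (omega hn hp hr c hct) (.sr 0) x = Sum.elim (x ∘ Sum.inr) (x ∘ Sum.inl) := by
  rw [ofMatrixHom_apply, omega, homOfGens_b, Matrix.fromBlocks_mulVec]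
  simp

lemma isSocleVector_of_jordan [IsAlgClosed k]
    {σ : Representation k (DihedralGroup n) (Fin r → k)} {c : k}
    (hσ : ∀ x, σ (.r 1) x = jordan r c *ᵥ x) (h0 : 0 < r) :
    IsSocleVector σ (Pi.single ⟨0, h0⟩ 1) := by
  refine ⟨by simp, fun W hW => ?_⟩
  obtain ⟨μ, z, hz, hne, h⟩ := exists_eigenvector_mem W hW (.r 1)
  obtain ⟨-, hz'⟩ := jordan_eigenvector h0 hne ((hσ z).symm.trans h)
  have hz0 : z ⟨0, h0⟩ ≠ 0 := fun h => hne (by rw [hz', h, zero_smul])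
  rw [hz'] at hz
  exact (W.toSubmodule.smul_mem_iff hz0).mp hz

/-- Since `c ≠ c⁻¹`, the two diagonal blocks share no eigenvalue, so an eigenvector lives in a
single block. -/
lemma omega_eigenvector (hn : n = p ^ s * t) (hp : ¬ p ∣ t) (hr : r ≤ p ^ s) {c : k}
    (hct : c ^ t = 1) (hc : c ^ 2 ≠ 1) (h0 : 0 < r) {μ : k} {z : Fin r ⊕ Fin r → k} (hz : z ≠ 0)
    (h : ofMatrixHom (omega hn hp hr c hct) (.r 1) z = μ • z) :
    (μ = c ∧ ∃ a : k, a ≠ 0 ∧ z = a • Pi.single (Sum.inl ⟨0, h0⟩) 1) ∨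
      (μ = c⁻¹ ∧ ∃ a : k, a ≠ 0 ∧ z = a • Pi.single (Sum.inr ⟨0, h0⟩) 1) := by
  have hc0 : c ≠ 0 := ne_zero_of_pow_eq_one hp hct
  have hl : jordan r c *ᵥ (z ∘ Sum.inl) = μ • (z ∘ Sum.inl) := by
    rw [← omega_rot_inl hn hp hr c hct, h]
    rfl
  -- The equation for `J⁻¹` is multiplied by `J`, so that it becomes one for `J` before `μ ≠ 0` is
  -- known.
  have hr' : z ∘ Sum.inr = μ • (jordan r c *ᵥ (z ∘ Sum.inr)) := by
    have h1 : (jordan r c)⁻¹ *ᵥ (z ∘ Sum.inr) = μ • (z ∘ Sum.inr) := by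
      rw [← omega_rot_inr hn hp hr c hct, h]
      rfl
    rw [← Matrix.mulVec_smul, ← h1, Matrix.mulVec_mulVec,
      Matrix.mul_nonsing_inv _ (isUnit_det_jordan hn hp hr c hct), Matrix.one_mulVec]
  have hr2 : z ∘ Sum.inr ≠ 0 → μ = c⁻¹ ∧
      z ∘ Sum.inr = z (Sum.inr ⟨0, h0⟩) • Pi.single ⟨0, h0⟩ 1 := by
    intro hne
    have hμ : μ ≠ 0 := by
      rintro rfl
      exact hne (by rw [hr', zero_smul])
    have h2 : jordan r c *ᵥ (z ∘ Sum.inr) = μ⁻¹ • (z ∘ Sum.inr) := by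
      conv_rhs => rw [hr', inv_smul_smul₀ hμ]
    obtain ⟨h3, h4⟩ := jordan_eigenvector h0 hne h2
    exact ⟨by rw [← h3, inv_inv], h4⟩
  by_cases hl0 : z ∘ Sum.inl = 0
  · have hr0 : z ∘ Sum.inr ≠ 0 := fun hr0 => hz <| by
      rw [← Sum.elim_comp_inl_inr z, hl0, hr0]
      exact Sum.elim_zero_zero
    obtain ⟨h1, h2⟩ := hr2 hr0
    refine Or.inr ⟨h1, z (Sum.inr ⟨0, h0⟩), fun h3 => hr0 (by rw [h2, h3, zero_smul]), ?_⟩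
    ext (i | i)
    · have := congrFun hl0 i
      simpa using this
    · have := congrFun h2 i
      simpa [Pi.single_apply] using this
  · obtain ⟨h1, h2⟩ := jordan_eigenvector h0 hl0 hl
    have hr0 : z ∘ Sum.inr = 0 := by
      by_contra hr0
      apply hc
      have := h1.symm.trans (hr2 hr0).1
      rw [sq]
      nth_rewrite 2 [this]
      exact mul_inv_cancel₀ hc0
    refine Or.inl ⟨h1, z (Sum.inl ⟨0, h0⟩), fun h3 => hl0 ?_, ?_⟩
    · rw [h2, Function.comp_apply, h3, zero_smul]
    ext (i | i)
    · have := congrFun h2 i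
      simpa [Pi.single_apply] using this
    · have := congrFun hr0 i
      simpa using this

lemma omega_refl_single_inr (hn : n = p ^ s * t) (hp : ¬ p ∣ t) (hr : r ≤ p ^ s) (c : k)
    (hct : c ^ t = 1) (i : Fin r) :
    ofMatrixHom (omega hn hp hr c hct) (.sr 0) (Pi.single (Sum.inr i) 1) =
      Pi.single (Sum.inl i) 1 := by
  rw [omega_refl]
  ext (l | l) <;> simp [Pi.single_apply]

lemma isSocleVector_omega [IsAlgClosed k] (hn : n = p ^ s * t) (hp : ¬ p ∣ t) (hr : r ≤ p ^ s)
    {c : k} (hct : c ^ t = 1) (hc : c ^ 2 ≠ 1) (h0 : 0 < r) :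
    IsSocleVector (ofMatrixHom (omega hn hp hr c hct)) (Pi.single (Sum.inl ⟨0, h0⟩) 1) := by
  refine ⟨by simp, fun W hW => ?_⟩
  obtain ⟨μ, z, hz, hne, h⟩ := exists_eigenvector_mem W hW (.r 1)
  obtain ⟨-, a, ha, rfl⟩ | ⟨-, a, ha, rfl⟩ := omega_eigenvector hn hp hr hct hc h0 hne h
  · exact (W.toSubmodule.smul_mem_iff ha).mp hz
  -- The reflection carries the eigenline of the second block to that of the first.
  · rw [← omega_refl_single_inr hn hp hr c hct]
    exact W.apply_mem_toSubmodule _ ((W.toSubmodule.smul_mem_iff ha).mp hz)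

end Models

/-! ### Eigenvalue invariants separating the models -/

section Invariants

variable {k : Type u} [Field k] {n : ℕ} {V : Type v} {M : Type w} [AddCommGroup V] [Module k V]
  [AddCommGroup M] [Module k M]

/-- `μ` is an eigenvalue of the rotation `r 1`. -/
def HasRotEigenvalue (ρ : Representation k (DihedralGroup n) V) (μ : k) : Prop :=
  ∃ z, z ≠ 0 ∧ ρ (.r 1) z = μ • z

/-- The generators `r 1` and `sr 0` have a common eigenvector with eigenvalues `μ` and `δ`. -/
def HasCommonEigenvalues (ρ : Representation k (DihedralGroup n) V) (μ δ : k) : Prop :=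
  ∃ z, z ≠ 0 ∧ ρ (.r 1) z = μ • z ∧ ρ (.sr 0) z = δ • z

lemma HasRotEigenvalue.of_equiv {ρ : Representation k (DihedralGroup n) V}
    {σ : Representation k (DihedralGroup n) M} (φ : ρ.Equiv σ) {μ : k}
    (h : HasRotEigenvalue ρ μ) : HasRotEigenvalue σ μ := by
  obtain ⟨z, hz, hμ⟩ := h
  refine ⟨φ.toLinearEquiv z, (map_ne_zero_iff _ φ.toLinearEquiv.injective).mpr hz, ?_⟩
  rw [← map_smul, ← hμ]
  exact (φ.toIntertwiningMap.isIntertwining _ _ _ _).symm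

lemma HasCommonEigenvalues.of_equiv {ρ : Representation k (DihedralGroup n) V}
    {σ : Representation k (DihedralGroup n) M} (φ : ρ.Equiv σ) {μ δ : k}
    (h : HasCommonEigenvalues ρ μ δ) : HasCommonEigenvalues σ μ δ := by
  obtain ⟨z, hz, hμ, hδ⟩ := h
  refine ⟨φ.toLinearEquiv z, (map_ne_zero_iff _ φ.toLinearEquiv.injective).mpr hz, ?_, ?_⟩
  · rw [← map_smul, ← hμ]
    exact (φ.toIntertwiningMap.isIntertwining _ _ _ _).symm
  · rw [← map_smul, ← hδ]
    exact (φ.toIntertwiningMap.isIntertwining _ _ _ _).symm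

lemma hasCommonEigenvalues_iff_of_jordan {r : ℕ}
    {σ : Representation k (DihedralGroup n) (Fin r → k)} {c ε : k}
    (hσ : ∀ x, σ (.r 1) x = jordan r c *ᵥ x) (h0 : 0 < r)
    (hε : σ (.sr 0) (Pi.single ⟨0, h0⟩ 1) = ε • Pi.single ⟨0, h0⟩ 1) {μ δ : k} :
    HasCommonEigenvalues σ μ δ ↔ μ = c ∧ δ = ε := by
  constructor
  · rintro ⟨z, hz, hμ, hδ⟩
    obtain ⟨h1, h2⟩ := jordan_eigenvector h0 hz ((hσ z).symm.trans hμ)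
    refine ⟨h1, ?_⟩
    rw [h2, map_smul, hε] at hδ
    have hz0 : z ⟨0, h0⟩ ≠ 0 := fun h => hz (by rw [h2, h, zero_smul])
    have := congrFun hδ ⟨0, h0⟩
    simp only [Pi.smul_apply, Pi.single_eq_same, smul_eq_mul, mul_one] at this
    exact (mul_left_cancel₀ hz0 (this.trans (mul_comm _ _))).symm
  · rintro ⟨rfl, rfl⟩
    refine ⟨Pi.single ⟨0, h0⟩ 1, by simp, ?_, hε⟩
    rw [hσ, jordan_mulVec_single, dif_neg (by simp), add_zero]

variable {p s t r : ℕ} [Fact p.Prime] [CharP k p]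

lemma omega_hasRotEigenvalue (hn : n = p ^ s * t) (hp : ¬ p ∣ t) (hr : r ≤ p ^ s) (c : k)
    (hct : c ^ t = 1) (h0 : 0 < r) : HasRotEigenvalue (ofMatrixHom (omega hn hp hr c hct)) c := by
  refine ⟨Pi.single (Sum.inl ⟨0, h0⟩) 1, by simp, ?_⟩
  have hl := omega_rot_inl hn hp hr c hct (Pi.single (Sum.inl ⟨0, h0⟩) 1)
  have hr' := omega_rot_inr hn hp hr c hct (Pi.single (Sum.inl ⟨0, h0⟩) 1)
  have h1 : (Pi.single (Sum.inl ⟨0, h0⟩) 1 : Fin r ⊕ Fin r → k) ∘ Sum.inl =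
      Pi.single ⟨0, h0⟩ 1 := by
    ext i; simp [Pi.single_apply]
  have h2 : (Pi.single (Sum.inl ⟨0, h0⟩) 1 : Fin r ⊕ Fin r → k) ∘ Sum.inr = 0 := by
    ext i; simp
  rw [h1, jordan_mulVec_single, dif_neg (by simp), add_zero, ← h1] at hl
  rw [h2, Matrix.mulVec_zero] at hr'
  ext (i | i)
  · exact congrFun hl i
  · refine (congrFun hr' i).trans ?_
    simp

lemma eq_or_eq_inv_of_omega_hasRotEigenvalue (hn : n = p ^ s * t) (hp : ¬ p ∣ t)
    (hr : r ≤ p ^ s) {c : k} (hct : c ^ t = 1) (hc : c ^ 2 ≠ 1) (h0 : 0 < r) {μ : k}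
    (h : HasRotEigenvalue (ofMatrixHom (omega hn hp hr c hct)) μ) : μ = c ∨ μ = c⁻¹ := by
  obtain ⟨z, hz, hμ⟩ := h
  exact (omega_eigenvector hn hp hr hct hc h0 hz hμ).imp And.left And.left

/-- An eigenvector of `a` lies in one block, and `b` moves it to the other. -/
lemma omega_not_hasCommonEigenvalues (hn : n = p ^ s * t) (hp : ¬ p ∣ t)
    (hr : r ≤ p ^ s) {c : k} (hct : c ^ t = 1) (hc : c ^ 2 ≠ 1) (h0 : 0 < r) (μ δ : k) :
    ¬ HasCommonEigenvalues (ofMatrixHom (omega hn hp hr c hct)) μ δ := by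
  rintro ⟨z, hz, hμ, hδ⟩
  rw [omega_refl] at hδ
  obtain ⟨-, a, ha, rfl⟩ | ⟨-, a, ha, rfl⟩ := omega_eigenvector hn hp hr hct hc h0 hz hμ
  · have := congrFun hδ (Sum.inr ⟨0, h0⟩)
    simp [ha] at this
  · have := congrFun hδ (Sum.inl ⟨0, h0⟩)
    simp [ha] at this

end Invariants

/-! ### Splitting a model off an arbitrary representation -/

section Completeness

variable {k : Type u} [Field k] {V : Type w} [AddCommGroup V] [Module k V]

/-- Factor the minimal polynomial as `(X - c) ^ r * q` with `q(c) ≠ 0`. By minimality `(A - c) ^ (r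
- 1) * q(A)` is nonzero at some `u`, with value `z`, an eigenvector for `c`. Since `q(A)` acts on
`z` by the nonzero scalar `q(c)`, the choices `v = q(A) u` and `f = g ∘ q(A)`, with `g z ≠ 0`, work.
-/
lemma exists_jordan_chain [Module.Finite k V] {A : Module.End k V} {c : k}
    (h : A.HasEigenvalue c) :
    ∃ r, 0 < r ∧ ∃ (v : V) (f : V →ₗ[k] k), ((A - algebraMap k _ c) ^ r) v = 0 ∧
      (∀ z, f (((A - algebraMap k _ c) ^ r) z) = 0) ∧
      f (((A - algebraMap k _ c) ^ (r - 1)) v) ≠ 0 := by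
  set y : Module.End k V := A - algebraMap k (Module.End k V) c with hy
  have hm0 : minpoly k A ≠ 0 := minpoly.ne_zero (Algebra.IsIntegral.isIntegral A)
  obtain ⟨q, hq, hndvd⟩ :=
    Polynomial.exists_eq_pow_rootMultiplicity_mul_and_not_dvd (minpoly k A) hm0 c
  set r := (minpoly k A).rootMultiplicity c
  have hr : 0 < r :=
    (Polynomial.rootMultiplicity_pos hm0).mpr (Module.End.isRoot_of_hasEigenvalue h)
  have hyX : Polynomial.aeval A (Polynomial.X - Polynomial.C c) = y := by simp [hy]
  have hyr : y ^ r * Polynomial.aeval A q = 0 := by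
    rw [← hyX, ← map_pow, ← map_mul, ← hq, minpoly.aeval]
  have hyr' : y ^ (r - 1) * Polynomial.aeval A q ≠ 0 := by
    rw [← hyX, ← map_pow, ← map_mul]
    intro h0
    have hdvd := minpoly.dvd k A h0
    rw [hq] at hdvd
    have hq0 : q ≠ 0 := by
      rintro rfl
      exact hndvd (dvd_zero _)
    have hdvd' := (mul_dvd_mul_iff_right hq0).mp hdvd
    have := (pow_dvd_pow_iff (Polynomial.X_sub_C_ne_zero c) (Polynomial.not_isUnit_X_sub_C c)).mp
      hdvd'
    omega
  obtain ⟨u, hu⟩ : ∃ u, (y ^ (r - 1) * Polynomial.aeval A q) u ≠ 0 := by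
    by_contra! h0
    exact hyr' (LinearMap.ext h0)
  set z := (y ^ (r - 1) * Polynomial.aeval A q) u with hz
  have hyz : y z = 0 := by
    rw [hz, ← Module.End.mul_apply, ← mul_assoc, ← pow_succ', Nat.sub_add_cancel hr, hyr,
      LinearMap.zero_apply]
  have hAz : A z = c • z := by
    rw [hy, LinearMap.sub_apply, Module.algebraMap_end_apply, sub_eq_zero] at hyz
    exact hyz
  have hqz : Polynomial.aeval A q z = q.eval c • z :=
    Module.End.aeval_apply_of_hasEigenvector ⟨Module.End.mem_eigenspace_iff.mpr hAz, hu⟩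
  have hqc : q.eval c ≠ 0 := fun h0 => hndvd (Polynomial.dvd_iff_isRoot.mpr h0)
  obtain ⟨g, hg⟩ : ∃ g : Module.Dual k V, g z ≠ 0 := by
    by_contra! h0
    exact hu ((Module.forall_dual_apply_eq_zero_iff k z).mp h0)
  have hcomm : Polynomial.aeval A q * y ^ r = y ^ r * Polynomial.aeval A q := by
    rw [← hyX, ← map_pow, ← map_mul, ← map_mul, mul_comm]
  refine ⟨r, hr, Polynomial.aeval A q u, g ∘ₗ Polynomial.aeval A q, ?_, fun x => ?_, ?_⟩
  · rw [← Module.End.mul_apply, hyr, LinearMap.zero_apply]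
  · rw [LinearMap.comp_apply, ← Module.End.mul_apply, hcomm, hyr, LinearMap.zero_apply, map_zero]
  · rw [LinearMap.comp_apply, ← Module.End.mul_apply (y ^ (r - 1)), ← hz, hqz, map_smul,
      smul_eq_mul]
    exact mul_ne_zero hqc hg

variable {p s t n r : ℕ} [Fact p.Prime] [CharP k p]

/-- By Frobenius `(A - c) ^ p ^ s = A ^ p ^ s - c ^ p ^ s`. If `r > p ^ s`, then `A ^ p ^ s` acts on
the span of `w, z` as a nontrivial Jordan block of size `2`; its `t`-th power is `1`, which forces
`t = 0` in `k`. -/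
lemma jordan_chain_length_le (hn : n = p ^ s * t) (hp : ¬ p ∣ t) {A : Module.End k V}
    (hA : A ^ n = 1) {c : k} (hct : c ^ t = 1) {v : V}
    (hv : ((A - algebraMap k _ c) ^ r) v = 0) (hv' : ((A - algebraMap k _ c) ^ (r - 1)) v ≠ 0) :
    r ≤ p ^ s := by
  by_contra! hlt
  have : Nontrivial V := ⟨_, _, hv'⟩
  have : CharP (Module.End k V) p :=
    charP_of_injective_algebraMap (algebraMap k (Module.End k V)).injective p
  set y : Module.End k V := A - algebraMap k (Module.End k V) c with hy
  have hq : 0 < p ^ s := pow_pos (Fact.out : p.Prime).pos s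
  have hyq : y ^ p ^ s = A ^ p ^ s - algebraMap k _ (c ^ p ^ s) := by
    rw [hy, map_pow]
    exact sub_pow_char_pow_of_commute p s (Algebra.commutes c A).symm
  set μ := c ^ p ^ s
  set z := (y ^ (r - 1)) v
  set w := (y ^ (r - 1 - p ^ s)) v
  have hCw : (A ^ p ^ s) w = μ • w + z := by
    have h1 : (y ^ p ^ s) w = z := by
      rw [← Module.End.mul_apply, ← pow_add]
      congr 2
      omega
    rw [hyq, LinearMap.sub_apply, Module.algebraMap_end_apply] at h1
    rw [← h1]
    abel
  have hCz : (A ^ p ^ s) z = μ • z := by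
    have h1 : (y ^ p ^ s) z = 0 := by
      have h2 : p ^ s + (r - 1) = (p ^ s - 1) + r := by omega
      rw [← Module.End.mul_apply, ← pow_add, h2, pow_add, Module.End.mul_apply, hv, map_zero]
    rwa [hyq, LinearMap.sub_apply, Module.algebraMap_end_apply, sub_eq_zero] at h1
  -- The extra factor `μ` avoids the exponent `m - 1` in the power of a Jordan block.
  have hind : ∀ m : ℕ, μ • ((A ^ p ^ s) ^ m) w = μ ^ (m + 1) • w + ((m : k) * μ ^ m) • z := by
    intro m
    induction m with
    | zero => simp
    | succ m ih =>
      rw [pow_succ' (A ^ p ^ s), Module.End.mul_apply, ← map_smul, ih, map_add, map_smul, map_smul,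
        hCw, hCz]
      push_cast
      module
  have ht := hind t
  have hμ : μ ^ t = 1 := by rw [← pow_mul, mul_comm, pow_mul, hct, one_pow]
  rw [← pow_mul, ← hn, hA, pow_succ, hμ, one_mul, mul_one, Module.End.one_apply,
    left_eq_add] at ht
  refine hp ((CharP.cast_eq_zero_iff k p t).mp ((smul_eq_zero.mp ht).resolve_right hv'))

/-- A Jordan chain whose last vector is an eigenvector of the reflection `sr 0`. -/
lemma exists_refl_eigen_chain {ρ : Representation k (DihedralGroup n) V} {c : k} (hc : c ^ 2 = 1)
    (h2 : (2 : k) ≠ 0) (hr : 0 < r) {v : V} {f : V →ₗ[k] k}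
    (hv : ((ρ (.r 1) - algebraMap k _ c) ^ r) v = 0)
    (hf : f (((ρ (.r 1) - algebraMap k _ c) ^ (r - 1)) v) ≠ 0) :
    ∃ (v' : V) (δ : k), δ ^ 2 = 1 ∧ ((ρ (.r 1) - algebraMap k _ c) ^ r) v' = 0 ∧
      f (((ρ (.r 1) - algebraMap k _ c) ^ (r - 1)) v') ≠ 0 ∧
      ρ (.sr 0) (((ρ (.r 1) - algebraMap k _ c) ^ (r - 1)) v') =
        δ • ((ρ (.r 1) - algebraMap k _ c) ^ (r - 1)) v' := by
  set A : Module.End k V := ρ (.r 1) with hA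
  set B : Module.End k V := ρ (.sr 0) with hB
  set y : Module.End k V := A - algebraMap k (Module.End k V) c with hy
  have hAz : ∀ {z}, y z = 0 ↔ A z = c • z := fun {z} => by
    rw [hy, LinearMap.sub_apply, Module.algebraMap_end_apply, sub_eq_zero]
  have hyy : ∀ x, y ((y ^ (r - 1)) x) = (y ^ r) x := fun x => by
    rw [← Module.End.mul_apply, ← pow_succ', Nat.sub_add_cancel hr]
  have hyB : ∀ z, y z = 0 → y (B z) = 0 := by
    intro z hz
    rw [hAz] at hz ⊢
    have h1 : A (B (A z)) = B z := rep_aba ρ z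
    rw [hz, map_smul, map_smul] at h1
    calc A (B z) = c • c • A (B z) := by rw [smul_smul, ← sq, hc, one_smul]
      _ = c • B z := by rw [h1]
  -- As `c ^ 2 = 1`, conjugation by `b` turns `a - c` into `a⁻¹ - c = -c a⁻¹ (a - c)`; `U` is this
  -- factor `-c a⁻¹`, which commutes with `y`.
  let R : Module.End k V := ρ (.r (-1))
  let U : Module.End k V := -c • R
  have hcommA : Commute R A := by
    rw [Commute, SemiconjBy, hA, ← map_mul, ← map_mul]
    simp
  have hcomm : Commute U y :=
    ((hcommA.sub_right (Algebra.commutes c _).symm).smul_left (-c))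
  have hBy : SemiconjBy B y (U * y) := by
    have h1 : R * A = 1 := by
      rw [hA, ← map_mul]
      simp
    have h3 : B * A = R * B := by
      rw [hA, hB, ← map_mul, ← map_mul]
      simp
    have h4 : U * y = R - algebraMap k _ c := by
      change (-c • R) * y = _
      rw [hy, smul_mul_assoc, mul_sub, h1, ← Algebra.commutes, ← Algebra.smul_def, smul_sub,
        smul_smul, neg_mul, ← sq, hc, Algebra.algebraMap_eq_smul_one]
      module
    rw [SemiconjBy, h4, sub_mul, hy, mul_sub, h3, Algebra.commutes]
  have hBz : ∀ x, B ((y ^ (r - 1)) x) = (y ^ (r - 1)) ((U ^ (r - 1)) (B x)) := by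
    intro x
    have h1 := (hBy.pow_right (r - 1)).eq
    rw [hcomm.mul_pow, (hcomm.pow_pow (r - 1) (r - 1)).eq] at h1
    exact LinearMap.congr_fun h1 x
  set z := (y ^ (r - 1)) v with hz
  have hyz : y z = 0 := (hyy v).trans hv
  -- The values for `δ = 1` and `δ = -1` add up to `2 f(z) ≠ 0`.
  obtain ⟨δ, hδ, hδz⟩ : ∃ δ : k, δ ^ 2 = 1 ∧ f (z + δ • B z) ≠ 0 := by
    by_contra! h0
    have h3 := h0 1 (by simp)
    have h4 := h0 (-1) (by simp)
    simp only [map_add, map_smul, smul_eq_mul] at h3 h4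
    refine mul_ne_zero h2 hf ?_
    linear_combination h3 + h4
  have hz' : (y ^ (r - 1)) (v + δ • (U ^ (r - 1)) (B v)) = z + δ • B z := by
    rw [map_add, map_smul, ← hBz]
  refine ⟨v + δ • (U ^ (r - 1)) (B v), δ, hδ, ?_, ?_, ?_⟩
  · rw [← hyy, hz', map_add, map_smul, hyz, hyB z hyz, smul_zero, add_zero]
  · rwa [hz']
  · rw [hz', map_add, map_smul, smul_add, smul_smul, ← sq, hδ, one_smul]
    have : B (B z) = z := rep_bb ρ z
    rw [this, add_comm]

/-- Since `b` acts by the same sign `δ` on the end `z` of the chain and on the socle vector `e`,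
both terms of each average agree there: `j e = z` and `π z = f(z) e`. No other value of `b` on the
model enters. -/
lemma nonempty_equiv_jordan [IsAlgClosed k] (hn : n ≠ 0) (h2 : (2 : k) ≠ 0)
    {ρ : Representation k (DihedralGroup n) V} (hρ : IsIndecomposable ρ) {c δ : k} (hδ : δ ^ 2 = 1)
    (hr : 0 < r) {v : V} {f : V →ₗ[k] k} (hv : ((ρ (.r 1) - algebraMap k _ c) ^ r) v = 0)
    (hf : ∀ z, f (((ρ (.r 1) - algebraMap k _ c) ^ r) z) = 0)
    (hfv : f (((ρ (.r 1) - algebraMap k _ c) ^ (r - 1)) v) ≠ 0)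
    (hb : ρ (.sr 0) (((ρ (.r 1) - algebraMap k _ c) ^ (r - 1)) v) =
        δ • ((ρ (.r 1) - algebraMap k _ c) ^ (r - 1)) v)
    {σ : Representation k (DihedralGroup n) (Fin r → k)}
    (hσ : ∀ x, σ (.r 1) x = jordan r c *ᵥ x)
    (hσb : σ (.sr 0) (Pi.single ⟨0, hr⟩ 1) = δ • Pi.single ⟨0, hr⟩ 1) :
    Nonempty (ρ.Equiv σ) := by
  set z := ((ρ (.r 1) - algebraMap k _ c) ^ (r - 1)) v with hz
  have hyz : (ρ (.r 1) - algebraMap k _ c) z = 0 := by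
    rw [hz, ← Module.End.mul_apply, ← pow_succ', Nat.sub_add_cancel hr, hv]
  let j := average hn ρ σ (jordanLift (ρ (.r 1)) c r v) fun x => by
    rw [hσ, jordanLift_jordan_mulVec hv]
  let π := average hn σ ρ (jordanColift (ρ (.r 1)) c r f) fun x => by
    rw [hσ, jordan_mulVec_jordanColift hf]
  have hj : j (Pi.single ⟨0, hr⟩ 1) = z := by
    have h1 : jordanLift (ρ (.r 1)) c r v (Pi.single ⟨0, hr⟩ 1) = z := by
      rw [jordanLift_single]
      simp only [Fin.val_rev, zero_add, hz]
    rw [average_apply, hσb, map_smul, h1, map_smul, hb, smul_smul, ← sq, hδ, one_smul,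
      ← two_smul k, inv_smul_smul₀ h2]
  have hπ : π z = f z • Pi.single ⟨0, hr⟩ 1 := by
    rw [average_apply, hb, map_smul, jordanColift_of_eigenvector f hr hyz, map_smul, map_smul, hσb,
      smul_comm (f z) δ, smul_smul δ, ← sq, hδ, one_smul, ← two_smul k, inv_smul_smul₀ h2]
  refine nonempty_equiv_of_apply_ne_zero hρ (isSocleVector_of_jordan hσ hr) j π ?_
  rw [hj, hπ]
  exact smul_ne_zero hfv (by simp)

lemma exists_equiv_phi [IsAlgClosed k] [Module.Finite k V] (hn : n = p ^ s * t) (hp : ¬ p ∣ t)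
    (h2 : (2 : k) ≠ 0) {ρ : Representation k (DihedralGroup n) V} (hρ : IsIndecomposable ρ) {c : k}
    (hct : c ^ t = 1) (hc : c ^ 2 = 1) (hA : Module.End.HasEigenvalue (ρ (.r 1)) c) :
    ∃ (r : ℕ) (hr : 1 ≤ r ∧ r ≤ p ^ s),
      Nonempty (ρ.Equiv (ofMatrixHom (phi hn hp hr.2 c hct hc))) ∨
      Nonempty (ρ.Equiv (ofMatrixHom (phi' hn hp hr.2 c hct hc))) := by
  obtain ⟨r, hr, v, f, hv, hf, hfv⟩ := exists_jordan_chain hA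
  obtain ⟨v', δ, hδ, hv', hfv', hb⟩ := exists_refl_eigen_chain hc h2 hr hv hfv
  have hle : r ≤ p ^ s := by
    refine jordan_chain_length_le hn hp ?_ hct hv' fun h => hfv' (by rw [h, map_zero])
    rw [← map_pow, DihedralGroup.r_one_pow_n, map_one]
  refine ⟨r, ⟨hr, hle⟩, ?_⟩
  have hn0 := ne_zero_of_eq hn hp
  have hδ' : δ = (-1) ^ (r - 1) ∨ δ = -(-1) ^ (r - 1) := by
    rw [← sq_eq_sq_iff_eq_or_eq_neg, hδ, ← pow_mul, mul_comm, pow_mul]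
    simp
  obtain rfl | rfl := hδ'
  · exact Or.inl (nonempty_equiv_jordan hn0 h2 hρ hδ hr hv' hf hfv' hb
      (phi_rot hn hp hle c hct hc) (phi_refl_single hn hp hle c hct hc hr))
  · exact Or.inr (nonempty_equiv_jordan hn0 h2 hρ hδ hr hv' hf hfv' hb
      (phi'_rot hn hp hle c hct hc) (phi'_refl_single hn hp hle c hct hc hr))

/-- The lift is extended by zero from the first block and the colift lands in it. As `b` exchanges
the blocks, the second term of each average cannot cancel the first, so any chain will do. -/
lemma exists_equiv_omega [IsAlgClosed k] [Module.Finite k V] (hn : n = p ^ s * t) (hp : ¬ p ∣ t)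
    (h2 : (2 : k) ≠ 0) {ρ : Representation k (DihedralGroup n) V} (hρ : IsIndecomposable ρ) {c : k}
    (hct : c ^ t = 1) (hc : c ^ 2 ≠ 1) (hA : Module.End.HasEigenvalue (ρ (.r 1)) c) :
    ∃ (r : ℕ) (hr : 1 ≤ r ∧ r ≤ p ^ s),
      Nonempty (ρ.Equiv (ofMatrixHom (omega hn hp hr.2 c hct))) := by
  obtain ⟨r, hr, v, f, hv, hf, hfv⟩ := exists_jordan_chain hA
  have hle : r ≤ p ^ s := by
    refine jordan_chain_length_le hn hp ?_ hct hv fun h => hfv (by rw [h, map_zero])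
    rw [← map_pow, DihedralGroup.r_one_pow_n, map_one]
  refine ⟨r, ⟨hr, hle⟩, ?_⟩
  have hn0 := ne_zero_of_eq hn hp
  set σ := ofMatrixHom (omega hn hp hle c hct) with hσ
  set z := ((ρ (.r 1) - algebraMap k _ c) ^ (r - 1)) v with hz
  have hyz : (ρ (.r 1) - algebraMap k _ c) z = 0 := by
    rw [hz, ← Module.End.mul_apply, ← pow_succ', Nat.sub_add_cancel hr, hv]
  let j := average hn0 ρ σ
    (jordanLift (ρ (.r 1)) c r v ∘ₗ LinearMap.funLeft k k Sum.inl) fun x => by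
      rw [LinearMap.comp_apply, LinearMap.comp_apply, ← jordanLift_jordan_mulVec hv]
      exact congrArg _ (omega_rot_inl hn hp hle c hct x)
  let e : (Fin r → k) →ₗ[k] (Fin r ⊕ Fin r → k) :=
    LinearMap.pi (Sum.elim (fun i => LinearMap.proj i) 0)
  have he : ∀ x, e x = Sum.elim x 0 := fun x => by
    ext (i | i) <;> simp [e]
  let π := average hn0 σ ρ (e ∘ₗ jordanColift (ρ (.r 1)) c r f) fun x => by
    rw [LinearMap.comp_apply, LinearMap.comp_apply, jordan_mulVec_jordanColift hf]
    have hl := omega_rot_inl hn hp hle c hct (e (jordanColift (ρ (.r 1)) c r f x))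
    have hr' := omega_rot_inr hn hp hle c hct (e (jordanColift (ρ (.r 1)) c r f x))
    rw [he, Sum.elim_comp_inl] at hl
    rw [he, Sum.elim_comp_inr, Matrix.mulVec_zero] at hr'
    rw [he, he, ← Sum.elim_comp_inl_inr (σ _ _), hσ, hl, hr']
  have hj : j (Pi.single (Sum.inl ⟨0, hr⟩) 1) = (2 : k)⁻¹ • z := by
    have h1 : (Pi.single (Sum.inl ⟨0, hr⟩) 1 : Fin r ⊕ Fin r → k) ∘ Sum.inl =
        Pi.single ⟨0, hr⟩ 1 := by
      ext i; simp [Pi.single_apply]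
    have h3 : (Pi.single (Sum.inl ⟨0, hr⟩) 1 : Fin r ⊕ Fin r → k) ∘ Sum.inr = 0 := by
      ext i; simp
    have h4 : ∀ x : Fin r ⊕ Fin r → k, LinearMap.funLeft k k Sum.inl x = x ∘ Sum.inl :=
      fun _ => rfl
    rw [average_apply, LinearMap.comp_apply, LinearMap.comp_apply, hσ, omega_refl, h4, h4, h1,
      Sum.elim_comp_inl, h3, map_zero, map_zero, add_zero, jordanLift_single]
    simp only [Fin.val_rev, zero_add, hz]
  refine nonempty_equiv_of_apply_ne_zero hρ (isSocleVector_omega hn hp hle hct hc hr) j π ?_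
  -- The reflected term lies in the second block, so it does not contribute to this coordinate.
  have hπ : π z (Sum.inl ⟨0, hr⟩) = (2 : k)⁻¹ * f z := by
    rw [average_apply, LinearMap.comp_apply, LinearMap.comp_apply,
      jordanColift_of_eigenvector f hr hyz, hσ, omega_refl, he, he]
    simp
  rw [hj, map_smul]
  refine smul_ne_zero (inv_ne_zero h2) fun h0 => ?_
  rw [h0, Pi.zero_apply] at hπ
  exact mul_ne_zero (inv_ne_zero h2) hfv hπ.symm

/-- From `a ^ n = 1` one gets `c ^ n = 1`, and in characteristic `p` the factor `p ^ s` of the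
exponent can be dropped. -/
lemma pow_eq_one_of_hasEigenvalue (hn : n = p ^ s * t)
    {ρ : Representation k (DihedralGroup n) V} {c : k} (hA : Module.End.HasEigenvalue (ρ (.r 1)) c) :
    c ^ t = 1 := by
  obtain ⟨z, hz⟩ := hA.exists_hasEigenvector
  have h1 := hz.pow_apply n
  rw [← map_pow, DihedralGroup.r_one_pow_n, map_one, Module.End.one_apply] at h1
  have h2 : (c ^ n - 1) • z = 0 := by rw [sub_smul, one_smul, ← h1, sub_self]
  have h3 := sub_eq_zero.mp ((smul_eq_zero.mp h2).resolve_right hz.2)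
  rw [hn] at h3
  exact (ExpChar.pow_prime_pow_mul_eq_one_iff p s t c).mp h3

/-- The reflection carries eigenvectors for `c` to eigenvectors for `c⁻¹`. -/
lemma hasEigenvalue_inv {ρ : Representation k (DihedralGroup n) V} {c : k} (hc : c ≠ 0)
    (hA : Module.End.HasEigenvalue (ρ (.r 1)) c) : Module.End.HasEigenvalue (ρ (.r 1)) c⁻¹ := by
  obtain ⟨z, hz⟩ := hA.exists_hasEigenvector
  refine Module.End.hasEigenvalue_of_hasEigenvector (x := ρ (.sr 0) z)
    ⟨Module.End.mem_eigenspace_iff.mpr ?_, fun h => hz.2 ?_⟩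
  · have h1 := rep_aba ρ z
    rw [hz.apply_eq_smul, map_smul, map_smul] at h1
    rw [← h1, inv_smul_smul₀ hc, h1]
  · rw [← rep_bb ρ z, h, map_zero]

end Completeness

/-! ### Pairwise non-isomorphism -/

section NonIsomorphic

variable {k : Type u} [Field k] {n r r' : ℕ}

lemma eq_of_jordan_equiv {σ : Representation k (DihedralGroup n) (Fin r → k)}
    {σ' : Representation k (DihedralGroup n) (Fin r' → k)} {c ε c' ε' : k} (h0 : 0 < r)
    (h0' : 0 < r') (hσ : ∀ x, σ (.r 1) x = jordan r c *ᵥ x)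
    (hσ' : ∀ x, σ' (.r 1) x = jordan r' c' *ᵥ x)
    (hε : σ (.sr 0) (Pi.single ⟨0, h0⟩ 1) = ε • Pi.single ⟨0, h0⟩ 1)
    (hε' : σ' (.sr 0) (Pi.single ⟨0, h0'⟩ 1) = ε' • Pi.single ⟨0, h0'⟩ 1)
    (φ : σ.Equiv σ') : r = r' ∧ c = c' ∧ ε = ε' := by
  refine ⟨by simpa using φ.toLinearEquiv.finrank_eq, ?_⟩
  rw [← hasCommonEigenvalues_iff_of_jordan hσ' h0' hε']
  exact ((hasCommonEigenvalues_iff_of_jordan hσ h0 hε).mpr ⟨rfl, rfl⟩).of_equiv φ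

variable {p s t : ℕ} [Fact p.Prime] [CharP k p] (hn : n = p ^ s * t) (hp : ¬ p ∣ t)
  (hr : 1 ≤ r ∧ r ≤ p ^ s) (hr' : 1 ≤ r' ∧ r' ≤ p ^ s) {c c' : k} (hct : c ^ t = 1)
  (hct' : c' ^ t = 1)

include hr hr'

lemma eq_of_phi_equiv_phi (hc : c ^ 2 = 1) (hc' : c' ^ 2 = 1)
    (φ : (ofMatrixHom (phi hn hp hr.2 c hct hc)).Equiv
      (ofMatrixHom (phi hn hp hr'.2 c' hct' hc'))) : r = r' ∧ c = c' :=
  (eq_of_jordan_equiv hr.1 hr'.1 (phi_rot hn hp hr.2 c hct hc)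
    (phi_rot hn hp hr'.2 c' hct' hc') (phi_refl_single ..)
    (phi_refl_single ..) φ).imp_right And.left

lemma eq_of_phi'_equiv_phi' (hc : c ^ 2 = 1) (hc' : c' ^ 2 = 1)
    (φ : (ofMatrixHom (phi' hn hp hr.2 c hct hc)).Equiv
      (ofMatrixHom (phi' hn hp hr'.2 c' hct' hc'))) : r = r' ∧ c = c' :=
  (eq_of_jordan_equiv hr.1 hr'.1 (phi'_rot hn hp hr.2 c hct hc)
    (phi'_rot hn hp hr'.2 c' hct' hc') (phi'_refl_single ..)
    (phi'_refl_single ..) φ).imp_right And.left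

/-- Equal dimensions make the signs of `b` on the two socle vectors opposite, whatever `c` and `c'`
are. -/
lemma isEmpty_phi_equiv_phi' (h2 : (2 : k) ≠ 0) (hc : c ^ 2 = 1) (hc' : c' ^ 2 = 1) :
    IsEmpty ((ofMatrixHom (phi hn hp hr.2 c hct hc)).Equiv
      (ofMatrixHom (phi' hn hp hr'.2 c' hct' hc'))) := by
  refine ⟨fun φ => ?_⟩
  obtain ⟨h1, -, h3⟩ := eq_of_jordan_equiv hr.1 hr'.1 (phi_rot hn hp hr.2 c hct hc)
    (phi'_rot hn hp hr'.2 c' hct' hc') (phi_refl_single ..) (phi'_refl_single ..) φ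
  rw [← h1, eq_neg_iff_add_eq_zero, ← two_mul] at h3
  exact mul_ne_zero h2 (pow_ne_zero _ (neg_ne_zero.mpr one_ne_zero)) h3

lemma isEmpty_phi_equiv_omega (hc : c ^ 2 = 1) (hc' : c' ^ 2 ≠ 1) :
    IsEmpty ((ofMatrixHom (phi hn hp hr.2 c hct hc)).Equiv
      (ofMatrixHom (omega hn hp hr'.2 c' hct'))) :=
  ⟨fun φ => omega_not_hasCommonEigenvalues hn hp hr'.2 hct' hc' hr'.1 _ _
    (((hasCommonEigenvalues_iff_of_jordan (phi_rot hn hp hr.2 c hct hc) hr.1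
      (phi_refl_single ..)).mpr ⟨rfl, rfl⟩).of_equiv φ)⟩

lemma isEmpty_phi'_equiv_omega (hc : c ^ 2 = 1) (hc' : c' ^ 2 ≠ 1) :
    IsEmpty ((ofMatrixHom (phi' hn hp hr.2 c hct hc)).Equiv
      (ofMatrixHom (omega hn hp hr'.2 c' hct'))) :=
  ⟨fun φ => omega_not_hasCommonEigenvalues hn hp hr'.2 hct' hc' hr'.1 _ _
    (((hasCommonEigenvalues_iff_of_jordan (phi'_rot hn hp hr.2 c hct hc) hr.1
      (phi'_refl_single ..)).mpr ⟨rfl, rfl⟩).of_equiv φ)⟩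

lemma eq_of_omega_equiv_omega (hc' : c' ^ 2 ≠ 1)
    (φ : (ofMatrixHom (omega hn hp hr.2 c hct)).Equiv
      (ofMatrixHom (omega hn hp hr'.2 c' hct'))) : r = r' ∧ (c = c' ∨ c = c'⁻¹) := by
  constructor
  · have := φ.toLinearEquiv.finrank_eq
    simp only [Module.finrank_fintype_fun_eq_card, Fintype.card_sum, Fintype.card_fin] at this
    omega
  · exact eq_or_eq_inv_of_omega_hasRotEigenvalue hn hp hr'.2 hct' hc' hr'.1
      ((omega_hasRotEigenvalue hn hp hr.2 c hct hr.1).of_equiv φ)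

end NonIsomorphic

/-! ### Roots of unity up to inversion -/

section PrimitiveRoot

variable {k : Type u} [Field k] {t : ℕ} {ξ : k}

lemma pow_sq_ne_one (hξ : IsPrimitiveRoot ξ t) {i : ℕ} (hi : 0 < i) (hit : 2 * i < t) :
    (ξ ^ i) ^ 2 ≠ 1 := by
  rw [← pow_mul, Ne, hξ.pow_eq_one_iff_dvd]
  intro h
  have := Nat.le_of_dvd (by omega) h
  omega

lemma eq_of_pow_eq_or_eq_inv (hξ : IsPrimitiveRoot ξ t) {i j : ℕ} (hi : 0 < i) (hit : 2 * i < t)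
    (hjt : 2 * j < t) (h : ξ ^ i = ξ ^ j ∨ ξ ^ i = (ξ ^ j)⁻¹) : i = j := by
  obtain h | h := h
  · exact hξ.pow_inj (by omega) (by omega) h
  · have hj : ξ ^ j ≠ 0 := pow_ne_zero _ (hξ.ne_zero (by omega))
    rw [← mul_eq_one_iff_eq_inv₀ hj, ← pow_add, hξ.pow_eq_one_iff_dvd] at h
    have := Nat.le_of_dvd (by omega) h
    omega

lemma pow_zero_ne_pow_half (hξ : IsPrimitiveRoot ξ t) (ht : Even t) (h0 : t ≠ 0) :
    ξ ^ 0 ≠ ξ ^ (t / 2) := by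
  obtain ⟨m, rfl⟩ := ht
  intro h
  have := hξ.pow_inj (by omega) (by omega) h
  omega

variable {V : Type w} [AddCommGroup V] [Module k V] {n p s : ℕ} [Fact p.Prime] [CharP k p]

/-- Eigenvalues of `a` are `t`-th roots of unity and come in inverse pairs, so the exponent can be
reflected into the lower half. -/
lemma exists_hasEigenvalue_pow [IsAlgClosed k] [Module.Finite k V] [Nontrivial V]
    (hn : n = p ^ s * t) (hp : ¬ p ∣ t) (hξ : IsPrimitiveRoot ξ t)
    (ρ : Representation k (DihedralGroup n) V) :
    ∃ i, 2 * i ≤ t ∧ Module.End.HasEigenvalue (ρ (.r 1)) (ξ ^ i) := by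
  obtain ⟨c, hA⟩ := Module.End.exists_eigenvalue (ρ (.r 1))
  have hct := pow_eq_one_of_hasEigenvalue hn hA
  have : NeZero t := ⟨fun h => hp (h ▸ dvd_zero p)⟩
  obtain ⟨j, hj, rfl⟩ := hξ.eq_pow_of_pow_eq_one hct
  by_cases hjt : 2 * j ≤ t
  · exact ⟨j, hjt, hA⟩
  · refine ⟨t - j, by omega, ?_⟩
    have hinv : ξ ^ (t - j) = (ξ ^ j)⁻¹ := by
      rw [← mul_eq_one_iff_eq_inv₀ (ne_zero_of_pow_eq_one hp hct), ← pow_add,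
        Nat.sub_add_cancel hj.le, hξ.pow_eq_one]
    rw [hinv]
    exact hasEigenvalue_inv (ne_zero_of_pow_eq_one hp hct) hA

end PrimitiveRoot

/-! ### Assembling the two classifications -/

section Families

variable {k : Type u} [Field k] [IsAlgClosed k] {p s t n : ℕ} [Fact p.Prime] [CharP k p]
  (hn : n = p ^ s * t) (hp : ¬ p ∣ t) {ξ : k} (hξ : IsPrimitiveRoot ξ t)

lemma two_ne_zero_of_charP_ne_two (k : Type u) [Field k] {p : ℕ} [Fact p.Prime] [CharP k p]
    (hp2 : p ≠ 2) : (2 : k) ≠ 0 := by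
  have h : ((2 : ℕ) : k) ≠ 0 := fun h => hp2
    ((Nat.prime_dvd_prime_iff_eq Fact.out Nat.prime_two).mp ((CharP.cast_eq_zero_iff k p 2).mp h))
  exact_mod_cast h

lemma isIndecomposable_phi {r : ℕ} (hr : 1 ≤ r ∧ r ≤ p ^ s) {c : k} (hct : c ^ t = 1)
    (hc : c ^ 2 = 1) : IsIndecomposable (ofMatrixHom (phi hn hp hr.2 c hct hc)) :=
  (isSocleVector_of_jordan (phi_rot hn hp hr.2 c hct hc) hr.1).isIndecomposable

lemma isIndecomposable_phi' {r : ℕ} (hr : 1 ≤ r ∧ r ≤ p ^ s) {c : k} (hct : c ^ t = 1)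
    (hc : c ^ 2 = 1) : IsIndecomposable (ofMatrixHom (phi' hn hp hr.2 c hct hc)) :=
  (isSocleVector_of_jordan (phi'_rot hn hp hr.2 c hct hc) hr.1).isIndecomposable

lemma isIndecomposable_omega {r : ℕ} (hr : 1 ≤ r ∧ r ≤ p ^ s) {c : k} (hct : c ^ t = 1)
    (hc : c ^ 2 ≠ 1) : IsIndecomposable (ofMatrixHom (omega hn hp hr.2 c hct)) :=
  (isSocleVector_omega hn hp hr.2 hct hc hr.1).isIndecomposable

theorem isComplete_oddFamily (hp2 : p ≠ 2) (ho : Odd n) :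
    IsCompleteIndecomposableFamily.{u, 0, w} (oddFamily hn hp hξ) := by
  have h2 := two_ne_zero_of_charP_ne_two k hp2
  have ht : Odd t := by
    rw [hn, Nat.odd_mul] at ho
    exact ho.2
  have hsq : ∀ i, 1 ≤ i ∧ i ≤ (t - 1) / 2 → (ξ ^ i) ^ 2 ≠ 1 := fun i hi =>
    pow_sq_ne_one hξ hi.1 (by omega)
  refine ⟨?_, ?_, ?_⟩
  · rintro (⟨r, hr⟩ | ⟨r, hr⟩ | ⟨r, i, hr, hi⟩)
    · exact ⟨inferInstanceAs (Module.Finite k (Fin r → k)), isIndecomposable_phi hn hp hr _ _⟩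
    · exact ⟨inferInstanceAs (Module.Finite k (Fin r → k)), isIndecomposable_phi' hn hp hr _ _⟩
    · exact ⟨inferInstanceAs (Module.Finite k (Fin r ⊕ Fin r → k)),
        isIndecomposable_omega hn hp hr _ (hsq i hi)⟩
  · rintro (⟨r, hr⟩ | ⟨r, hr⟩ | ⟨r, i, hr, hi⟩) (⟨r', hr'⟩ | ⟨r', hr'⟩ | ⟨r', i', hr', hi'⟩) ⟨φ⟩
    · obtain ⟨rfl, -⟩ := eq_of_phi_equiv_phi hn hp hr hr' _ _ _ _ φ
      rfl
    · exact ((isEmpty_phi_equiv_phi' hn hp hr hr' _ _ h2 _ _).false φ).elim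
    · exact ((isEmpty_phi_equiv_omega hn hp hr hr' _ _ _ (hsq i' hi')).false φ).elim
    · exact ((isEmpty_phi_equiv_phi' hn hp hr' hr _ _ h2 _ _).false φ.symm).elim
    · obtain ⟨rfl, -⟩ := eq_of_phi'_equiv_phi' hn hp hr hr' _ _ _ _ φ
      rfl
    · exact ((isEmpty_phi'_equiv_omega hn hp hr hr' _ _ _ (hsq i' hi')).false φ).elim
    · exact ((isEmpty_phi_equiv_omega hn hp hr' hr _ _ _ (hsq i hi)).false φ.symm).elim
    · exact ((isEmpty_phi'_equiv_omega hn hp hr' hr _ _ _ (hsq i hi)).false φ.symm).elim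
    · obtain ⟨rfl, h⟩ := eq_of_omega_equiv_omega hn hp hr hr' _ _ (hsq i' hi') φ
      obtain rfl := eq_of_pow_eq_or_eq_inv hξ hi.1 (by omega) (by omega) h
      rfl
  · intro V _ _ _ ρ hρ
    have := hρ.1
    obtain ⟨i, hi, hA⟩ := exists_hasEigenvalue_pow hn hp hξ ρ
    obtain rfl | hi0 := Nat.eq_zero_or_pos i
    · obtain ⟨r, hr, h | h⟩ :=
        exists_equiv_phi hn hp h2 hρ (pow_pow_eq_one hξ 0) (pow_zero_sq ξ) hA
      · exact ⟨.phi r hr, h⟩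
      · exact ⟨.phi' r hr, h⟩
    -- For odd `t`, `2 * i ≤ t` is never an equality, so `1` is the only self-inverse case.
    · have hit : i ≤ (t - 1) / 2 := by
        obtain ⟨m, rfl⟩ := ht
        omega
      obtain ⟨r, hr, h⟩ :=
        exists_equiv_omega hn hp h2 hρ (pow_pow_eq_one hξ i) (hsq i ⟨hi0, hit⟩) hA
      exact ⟨.omega r i hr ⟨hi0, hit⟩, h⟩

theorem isComplete_evenFamily (hp2 : p ≠ 2) (he : Even n) :
    IsCompleteIndecomposableFamily.{u, 0, w} (evenFamily hn hp hp2 he hξ) := by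
  have h2 := two_ne_zero_of_charP_ne_two k hp2
  have ht : Even t := by
    have he' := he
    rw [hn, Nat.even_mul] at he'
    exact he'.resolve_left
      (Nat.not_even_iff_odd.mpr (((Fact.out : p.Prime).odd_of_ne_two hp2).pow))
  have hne := pow_zero_ne_pow_half hξ ht fun h => hp (h ▸ dvd_zero p)
  have hsq : ∀ i, 1 ≤ i ∧ i ≤ t / 2 - 1 → (ξ ^ i) ^ 2 ≠ 1 := fun i hi =>
    pow_sq_ne_one hξ hi.1 (by omega)
  refine ⟨?_, ?_, ?_⟩
  · rintro (⟨r, hr⟩ | ⟨r, hr⟩ | ⟨r, hr⟩ | ⟨r, hr⟩ | ⟨r, i, hr, hi⟩)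
    · exact ⟨inferInstanceAs (Module.Finite k (Fin r → k)), isIndecomposable_phi hn hp hr _ _⟩
    · exact ⟨inferInstanceAs (Module.Finite k (Fin r → k)), isIndecomposable_phi' hn hp hr _ _⟩
    · exact ⟨inferInstanceAs (Module.Finite k (Fin r → k)), isIndecomposable_phi hn hp hr _ _⟩
    · exact ⟨inferInstanceAs (Module.Finite k (Fin r → k)), isIndecomposable_phi' hn hp hr _ _⟩
    · exact ⟨inferInstanceAs (Module.Finite k (Fin r ⊕ Fin r → k)),
        isIndecomposable_omega hn hp hr _ (hsq i hi)⟩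
  · rintro (⟨r, hr⟩ | ⟨r, hr⟩ | ⟨r, hr⟩ | ⟨r, hr⟩ | ⟨r, i, hr, hi⟩)
      (⟨r', hr'⟩ | ⟨r', hr'⟩ | ⟨r', hr'⟩ | ⟨r', hr'⟩ | ⟨r', i', hr', hi'⟩) ⟨φ⟩
    · obtain ⟨rfl, -⟩ := eq_of_phi_equiv_phi hn hp hr hr' _ _ _ _ φ
      rfl
    · exact ((isEmpty_phi_equiv_phi' hn hp hr hr' _ _ h2 _ _).false φ).elim
    · exact (hne (eq_of_phi_equiv_phi hn hp hr hr' _ _ _ _ φ).2).elim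
    · exact ((isEmpty_phi_equiv_phi' hn hp hr hr' _ _ h2 _ _).false φ).elim
    · exact ((isEmpty_phi_equiv_omega hn hp hr hr' _ _ _ (hsq i' hi')).false φ).elim
    · exact ((isEmpty_phi_equiv_phi' hn hp hr' hr _ _ h2 _ _).false φ.symm).elim
    · obtain ⟨rfl, -⟩ := eq_of_phi'_equiv_phi' hn hp hr hr' _ _ _ _ φ
      rfl
    · exact ((isEmpty_phi_equiv_phi' hn hp hr' hr _ _ h2 _ _).false φ.symm).elim
    · exact (hne (eq_of_phi'_equiv_phi' hn hp hr hr' _ _ _ _ φ).2).elim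
    · exact ((isEmpty_phi'_equiv_omega hn hp hr hr' _ _ _ (hsq i' hi')).false φ).elim
    · exact (hne (eq_of_phi_equiv_phi hn hp hr hr' _ _ _ _ φ).2.symm).elim
    · exact ((isEmpty_phi_equiv_phi' hn hp hr hr' _ _ h2 _ _).false φ).elim
    · obtain ⟨rfl, -⟩ := eq_of_phi_equiv_phi hn hp hr hr' _ _ _ _ φ
      rfl
    · exact ((isEmpty_phi_equiv_phi' hn hp hr hr' _ _ h2 _ _).false φ).elim
    · exact ((isEmpty_phi_equiv_omega hn hp hr hr' _ _ _ (hsq i' hi')).false φ).elim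
    · exact ((isEmpty_phi_equiv_phi' hn hp hr' hr _ _ h2 _ _).false φ.symm).elim
    · exact (hne (eq_of_phi'_equiv_phi' hn hp hr hr' _ _ _ _ φ).2.symm).elim
    · exact ((isEmpty_phi_equiv_phi' hn hp hr' hr _ _ h2 _ _).false φ.symm).elim
    · obtain ⟨rfl, -⟩ := eq_of_phi'_equiv_phi' hn hp hr hr' _ _ _ _ φ
      rfl
    · exact ((isEmpty_phi'_equiv_omega hn hp hr hr' _ _ _ (hsq i' hi')).false φ).elim
    · exact ((isEmpty_phi_equiv_omega hn hp hr' hr _ _ _ (hsq i hi)).false φ.symm).elim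
    · exact ((isEmpty_phi'_equiv_omega hn hp hr' hr _ _ _ (hsq i hi)).false φ.symm).elim
    · exact ((isEmpty_phi_equiv_omega hn hp hr' hr _ _ _ (hsq i hi)).false φ.symm).elim
    · exact ((isEmpty_phi'_equiv_omega hn hp hr' hr _ _ _ (hsq i hi)).false φ.symm).elim
    · obtain ⟨rfl, h⟩ := eq_of_omega_equiv_omega hn hp hr hr' _ _ (hsq i' hi') φ
      obtain rfl := eq_of_pow_eq_or_eq_inv hξ hi.1 (by omega) (by omega) h
      rfl
  · intro V _ _ _ ρ hρ
    have := hρ.1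
    obtain ⟨i, hi, hA⟩ := exists_hasEigenvalue_pow hn hp hξ ρ
    obtain rfl | hi0 := Nat.eq_zero_or_pos i
    · obtain ⟨r, hr, h | h⟩ :=
        exists_equiv_phi hn hp h2 hρ (pow_pow_eq_one hξ 0) (pow_zero_sq ξ) hA
      · exact ⟨.phi r hr, h⟩
      · exact ⟨.phi' r hr, h⟩
    -- The exponent `t / 2` gives the second self-inverse eigenvalue.
    by_cases hih : i = t / 2
    · subst hih
      obtain ⟨r, hr, h | h⟩ :=
        exists_equiv_phi hn hp h2 hρ (pow_pow_eq_one hξ _) (pow_half_sq hn hp2 he hξ) hA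
      · exact ⟨.phiHalf r hr, h⟩
      · exact ⟨.phiHalf' r hr, h⟩
    · have hit : i ≤ t / 2 - 1 := by omega
      obtain ⟨r, hr, h⟩ :=
        exists_equiv_omega hn hp h2 hρ (pow_pow_eq_one hξ i) (hsq i ⟨hi0, hit⟩) hA
      exact ⟨.omega r i hr ⟨hi0, hit⟩, h⟩

end Families

end DihedralRep

end

theorem mainTheorem3 {k : Type u} [Field k] [IsAlgClosed k] {p : ℕ} [Fact p.Prime] [CharP k p]
    (hp2 : p ≠ 2) {s t n : ℕ} (hn : n = p ^ s * t) (hp : ¬ p ∣ t) {ξ : k}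
    (hξ : IsPrimitiveRoot ξ t) :
    (Odd n →
      DihedralRep.IsCompleteIndecomposableFamily.{u, 0, w} (DihedralRep.oddFamily hn hp hξ)) ∧
    (∀ he : Even n,
      DihedralRep.IsCompleteIndecomposableFamily.{u, 0, w}
        (DihedralRep.evenFamily hn hp hp2 he hξ)) :=
  ⟨DihedralRep.isComplete_oddFamily hn hp hξ hp2, DihedralRep.isComplete_evenFamily hn hp hξ hp2⟩
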